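/- All algorithms are uniform deterministic programs on a unit-cost word RAM whose words have $O(\log n)$ bits. For positive reals $p,q,s$, let $\omega(p,q,s)$ denote the exponent of rectangular matrix multiplication, that is, the infimum of all $\tau\in\mathbb R$ such that an $\lfloor n^p\rfloor\times\lfloor n^q\rfloor$ matrix and an $\lfloor n^q\rfloor\times\lfloor n^s\rfloor$ matrix with integer entries of absolute value $n^{O(1)}$ can be multiplied in $O(n^\tau)$ time. Since this is an infimum, a bound $O(n^{\omega(p,q,s)})$ means, as usual, $O(n^{\omega(p,q,s)+\varepsilon})$ for every fixed $\varepsilon>0$; moreover it holds with $\omega(p,q,s)$ replaced by any $\tau$ for which the multiplication above can be done in $O(n^\tau)$ time (so it holds literally whenever the infimum is attained). The same convention applies to $\tilde O$, which in addition hides factors $(\log n)^{O(1)}$. A copy of $K_r$ in a simple undirected graph $G$ is a subgraph of $G$ isomorphic to the complete graph $K_r$; graphs are given by their adjacency matrices. **Corollary.** The number of copies of $K_4$ in an $n$-vertex graph can be computed in $O(n^{\omega(2,1,1)})$ time, and the number of copies of $K_5$ in $O(n^{\omega(2,1,2)})$ time. Moreover, if the input graph contains a copy of $K_4$ (respectively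 $K_5$), then such a copy can be found in $\tilde O(n^{\omega(2,1,1)})$ time (respectively $\tilde O(n^{\omega(2,1,2)})$ time). -/

import Mathlib

/-! ### A word RAM

Programs are finite pieces of text, the same for all input sizes, that work on integer registers and
on finitely many integer arrays (a RAM with one memory simulates the arrays by interleaving them).
Every operation has unit cost.  All values that occur, addresses included, have to stay within a
bound `M`: an operation that would leave the range `[-M, M]` has no execution.  Running times below
always come with a bound `M` that is polynomial in the size parameter, that is, words have
`O(log n)` bits. -/

namespace WordRAM

/-- A memory configuration: register `x` holds `reg x`, cell `i` of array `a` holds `arr a i`. -/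
structure State where
  reg : ℕ → ℤ
  arr : ℕ → ℤ → ℤ

/-- The binary machine operations. -/
inductive Op
  | add | sub | mul | div | mod | le | eq

/-- Comparisons return `1` or `0`; division and remainder by zero return `0` and the dividend. -/
def Op.eval : Op → ℤ → ℤ → ℤ
  | .add, u, v => u + v
  | .sub, u, v => u - v
  | .mul, u, v => u * v
  | .div, u, v => u / v
  | .mod, u, v => u % v
  | .le, u, v => if u ≤ v then 1 else 0
  | .eq, u, v => if u = v then 1 else 0

/-- Expressions: constants, registers, array look-ups (indirect addressing), operations. -/
inductive Expr
  | const (z : ℤ)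
  | reg (x : ℕ)
  | load (a : ℕ) (i : Expr)
  | op (o : Op) (e f : Expr)

/-- The value of an expression. -/
def Expr.eval (s : State) : Expr → ℤ
  | .const z => z
  | .reg x => s.reg x
  | .load a i => s.arr a (i.eval s)
  | .op o e f => o.eval (e.eval s) (f.eval s)

/-- The number of elementary steps that the evaluation of an expression takes. -/
def Expr.cost : Expr → ℕ
  | .const _ => 1
  | .reg _ => 1
  | .load _ i => i.cost + 1
  | .op _ e f => e.cost + f.cost + 1

/-- All values that occur in the evaluation of the expression fit into a machine word. -/
def Expr.Fits (M : ℕ) (s : State) : Expr → Prop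
  | .const z => |z| ≤ (M : ℤ)
  | .reg x => |s.reg x| ≤ (M : ℤ)
  | .load a i => i.Fits M s ∧ |s.arr a (i.eval s)| ≤ (M : ℤ)
  | .op o e f => e.Fits M s ∧ f.Fits M s ∧ |o.eval (e.eval s) (f.eval s)| ≤ (M : ℤ)

/-- Write to a register. -/
def State.setReg (s : State) (x : ℕ) (v : ℤ) : State :=
  { s with reg := Function.update s.reg x v }

/-- Write to a cell of an array. -/
def State.setArr (s : State) (a : ℕ) (i v : ℤ) : State :=
  { s with arr := Function.update s.arr a (Function.update (s.arr a) i v) }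

/-- Programs. A test succeeds when its value is nonzero. -/
inductive Prog
  | skip
  | assign (x : ℕ) (e : Expr)
  | store (a : ℕ) (i e : Expr)
  | seq (P Q : Prog)
  | ite (e : Expr) (P Q : Prog)
  | while (e : Expr) (P : Prog)

/-- `Exec M P s t s'`: started in `s`, the program `P` halts in `s'` after exactly `t` steps, and
all values that occur on the way lie in `[-M, M]`. -/
inductive Exec (M : ℕ) : Prog → State → ℕ → State → Prop
  | skip (s : State) : Exec M .skip s 1 s
  | assign (s : State) (x : ℕ) (e : Expr) (he : e.Fits M s) :
      Exec M (.assign x e) s (e.cost + 1) (s.setReg x (e.eval s))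
  | store (s : State) (a : ℕ) (i e : Expr) (hi : i.Fits M s) (he : e.Fits M s) :
      Exec M (.store a i e) s (i.cost + e.cost + 1) (s.setArr a (i.eval s) (e.eval s))
  | seq (P Q : Prog) (s s' s'' : State) (t t' : ℕ) (hP : Exec M P s t s')
      (hQ : Exec M Q s' t' s'') : Exec M (.seq P Q) s (t + t') s''
  | ite_true (e : Expr) (P Q : Prog) (s s' : State) (t : ℕ) (he : e.Fits M s)
      (h : e.eval s ≠ 0) (hP : Exec M P s t s') : Exec M (.ite e P Q) s (e.cost + 1 + t) s'
  | ite_false (e : Expr) (P Q : Prog) (s s' : State) (t : ℕ) (he : e.Fits M s)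
      (h : e.eval s = 0) (hQ : Exec M Q s t s') : Exec M (.ite e P Q) s (e.cost + 1 + t) s'
  | while_true (e : Expr) (P : Prog) (s s' s'' : State) (t t' : ℕ) (he : e.Fits M s)
      (h : e.eval s ≠ 0) (hP : Exec M P s t s') (hW : Exec M (.while e P) s' t' s'') :
      Exec M (.while e P) s (e.cost + 1 + t + t') s''
  | while_false (e : Expr) (P : Prog) (s : State) (he : e.Fits M s) (h : e.eval s = 0) :
      Exec M (.while e P) s (e.cost + 1) s

/-- A computational problem: instances with a size parameter, the initial memory that encodes an
instance, and the final memories that contain a correct answer to it. -/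
structure Problem where
  Inst : Type
  size : Inst → ℕ
  input : Inst → State
  Correct : Inst → State → Prop

/-- On words of `O(log n)` bits, the program `P` halts with a correct answer on every instance, and
takes `O(T n)` steps on the instances with size parameter `n`. -/
def SolvesInTime (P : Prog) (Q : Problem) (T : ℕ → ℝ) : Prop :=
  ∃ (t M : ℕ → ℕ) (k : ℕ),
    (fun n => (t n : ℝ)) =O[Filter.atTop] T ∧
    (fun n => (M n : ℝ)) =O[Filter.atTop] (fun n : ℕ => (n : ℝ) ^ k) ∧
    ∀ x : Q.Inst, ∃ (r : ℕ) (s' : State), Exec (M (Q.size x)) P (Q.input x) r s' ∧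
      r ≤ t (Q.size x) ∧ Q.Correct x s'

/-- The contents of an array that holds the matrix `A` row by row: the entry `A i j` is in cell
`i * b + j`, and the other cells are zero. -/
def rowMajor {a b : ℕ} (A : Matrix (Fin a) (Fin b) ℤ) (z : ℤ) : ℤ :=
  ∑ i : Fin a, ∑ j : Fin b, if z = (i : ℤ) * b + j then A i j else 0

/-- A memory in which the registers `0, 1, …` and the arrays `0, 1, …` hold the listed contents and
everything else is zero. -/
def initial (regs : List ℤ) (arrs : List (ℤ → ℤ)) : State where
  reg x := regs.getD x 0
  arr a := arrs.getD a (fun _ => 0)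

end WordRAM

open WordRAM

/-! ### Rectangular matrix multiplication -/

/-- `⌊n ^ p⌋`. -/
noncomputable def powDim (n : ℕ) (p : ℝ) : ℕ := ⌊(n : ℝ) ^ p⌋₊

/-- Two matrices of sizes `n ^ p × n ^ q` and `n ^ q × n ^ s` with integer entries of absolute value
at most `n ^ d`. -/
structure MatPair (p q s : ℝ) (d : ℕ) where
  n : ℕ
  A : Matrix (Fin (powDim n p)) (Fin (powDim n q)) ℤ
  B : Matrix (Fin (powDim n q)) (Fin (powDim n s)) ℤ
  hA : ∀ i j, |A i j| ≤ (n : ℤ) ^ d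
  hB : ∀ i j, |B i j| ≤ (n : ℤ) ^ d

/-- Multiplication of such matrices. The three dimensions are given in the registers `0, 1, 2` and
the factors in the arrays `0, 1`; the product is to be left in array `2`. -/
noncomputable def matMulProblem (p q s : ℝ) (d : ℕ) : Problem where
  Inst := MatPair p q s d
  size x := x.n
  input x := initial [powDim x.n p, powDim x.n q, powDim x.n s] [rowMajor x.A, rowMajor x.B]
  Correct x s' := ∀ (i : Fin (powDim x.n p)) (k : Fin (powDim x.n s)),
    s'.arr 2 ((i : ℤ) * powDim x.n s + k) = (x.A * x.B) i k

/-- Rectangular `n ^ p × n ^ q` by `n ^ q × n ^ s` integer matrices with entries of `O(log n)` bits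
can be multiplied in time `O(n ^ τ)`. -/
def MatMulInTime (p q s τ : ℝ) : Prop :=
  ∃ P : Prog, ∀ d : ℕ, SolvesInTime P (matMulProblem p q s d) (fun n => (n : ℝ) ^ τ)

/-- The exponent `ω(p, q, s)` of rectangular matrix multiplication. -/
noncomputable def omega (p q s : ℝ) : ℝ := sInf {τ : ℝ | MatMulInTime p q s τ}

/-! ### Counting and finding complete subgraphs -/

/-- Graphs with vertices `0, …, n - 1`, for arbitrary `n`. -/
structure HostGraph where
  n : ℕ
  G : SimpleGraph (Fin n)

open Classical in
/-- The graph is given by `n` in register `0` and its adjacency matrix in array `0`. -/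
noncomputable def HostGraph.input (x : HostGraph) : State :=
  initial [(x.n : ℤ)] [rowMajor (x.G.adjMatrix ℤ)]

/-- Compute the number of subgraphs that are isomorphic to `K_r`; the answer is to be left in
register `0`. -/
noncomputable def countCliquesProblem (r : ℕ) : Problem where
  Inst := HostGraph
  size x := x.n
  input x := x.input
  Correct x s' := s'.reg 0 = (x.G.copyCount (SimpleGraph.completeGraph (Fin r)) : ℤ)

/-- In a graph that contains a copy of `K_r`, find one; its vertices are to be left in the registers
`0, …, r - 1`. -/
noncomputable def findCliqueProblem (r : ℕ) : Problem where
  Inst := {x : HostGraph // (SimpleGraph.completeGraph (Fin r)).IsContained x.G}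
  size x := x.1.n
  input x := x.1.input
  Correct x s' := ∃ f : (SimpleGraph.completeGraph (Fin r)).Copy x.1.G, ∀ i : Fin r, s'.reg i = (f i : ℤ)

/-- The number of copies of `K_r` in an `n`-vertex graph can be computed in time `O(T n)`. -/
def CountCliquesInTime (r : ℕ) (T : ℕ → ℝ) : Prop :=
  ∃ P : Prog, SolvesInTime P (countCliquesProblem r) T

/-- In an `n`-vertex graph that contains a copy of `K_r`, such a copy can be found in time
`Õ(T n)`, that is, in time `O(T n * (log n) ^ k)` for some `k`. -/
def FindCliqueInSoftTime (r : ℕ) (T : ℕ → ℝ) : Prop :=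
  ∃ (k : ℕ) (P : Prog), SolvesInTime P (findCliqueProblem r) (fun n => T n * Real.log n ^ k)

/-!
For `r = p + q + s` with `1 ≤ q ≤ p, s`, complete subgraphs on `r` vertices are counted and found
by a single multiplication of an `n ^ p × n ^ q` and an `n ^ q × n ^ s` matrix; the theorem is the
case of `(p, q, s) = (2, 1, 1)` and `(2, 1, 2)`.

A complete subgraph is an increasing `r`-tuple of vertices, any two of which are adjacent
(`SimpleGraph.card_isCliqueCode`), and the tuple is split into three parts `k`, `j`, `i` of
lengths `s`, `q`, `p`. It is a complete subgraph if and only if each two of the three parts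
together are one (`SimpleGraph.isCliqueCode_glue`). So let the entries of the two matrices say
whether `j, i` and whether `k, j` are increasing complete subgraphs: the entry `(i, k)` of the
product is the number of the tuples `j` that fit to both, and the sum of the entries over all
`(i, k)` that form a complete subgraph themselves is the number of copies of `K_r`
(`HostGraph.sum_cliqueInd_mul_productEntry`). Tuples are encoded by their base `n` expansion, so
that the cells of a matrix stored by rows are numbered by the concatenated tuples. To find a copy,
one searches for a nonzero term of this sum, and then for a tuple `j` that contributes to it. This
is deterministic and needs no logarithmic factor.

Apart from the multiplication, all this takes `O(n ^ (p + s))` steps, as `q ≤ p` and `q ≤ s`. That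
is within the time of the multiplication, because a multiplication program has to write
`n ^ (p + s)` nonzero cells when all entries of the factors are `1`
(`MatMulInTime.exists_multipliesBits`). The program given for the multiplication runs as a
subroutine with renumbered registers and arrays (`WordRAM.Exec.shift`), and the other parts are
loops that count down, with the rule `WordRAM.Halts.countdown`.

For the bounds with `omega`, an infimum, some exponent must be known to be attained at all:
multiplication by the definition takes time `O(n ^ (p + q + s))` (`matMulInTime_naive`).
-/

/-! ### Digits in base `n` -/

/-- The `m` lowest digits of `z` in base `n`, the lowest first. Numbers below `n ^ m` stand in this
way for the `m`-tuples of vertices of a graph on `0, …, n - 1`. -/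
def digitList (n : ℕ) : ℕ → ℕ → List ℕ
  | 0, _ => []
  | m + 1, z => z % n :: digitList n m (z / n)

@[simp] lemma length_digitList (n m z : ℕ) : (digitList n m z).length = m := by
  induction m generalizing z with
  | zero => rfl
  | succ m ih => simp [digitList, ih]

lemma lt_of_mem_digitList {n m z a : ℕ} (hn : 0 < n) (ha : a ∈ digitList n m z) : a < n := by
  induction m generalizing z with
  | zero => simp [digitList] at ha
  | succ m ih =>
    rcases List.mem_cons.1 ha with rfl | h
    exacts [Nat.mod_lt _ hn, ih h]

lemma digitList_add {n m x : ℕ} (l y : ℕ) (hx : x < n ^ m) :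
    digitList n (m + l) (x + n ^ m * y) = digitList n m x ++ digitList n l y := by
  induction m generalizing x with
  | zero =>
    obtain rfl : x = 0 := by simpa using hx
    simp [digitList]
  | succ m ih =>
    have hn : 0 < n := Nat.pos_of_ne_zero fun h => by simp [h] at hx
    have h1 : n ^ (m + 1) * y = n * (n ^ m * y) := by ring
    have h2 : x / n < n ^ m := by
      rw [Nat.div_lt_iff_lt_mul hn]; rwa [pow_succ] at hx
    rw [show m + 1 + l = (m + l) + 1 by ring, digitList, digitList, h1,
      Nat.add_mul_mod_self_left, Nat.add_mul_div_left _ _ hn, ih h2, List.cons_append]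

lemma ofDigits_digitList {n m z : ℕ} (hz : z < n ^ m) : Nat.ofDigits n (digitList n m z) = z := by
  induction m generalizing z with
  | zero => simpa [digitList, eq_comm] using hz
  | succ m ih =>
    have hn : 0 < n := Nat.pos_of_ne_zero fun h => by simp [h] at hz
    have h2 : z / n < n ^ m := by
      rw [Nat.div_lt_iff_lt_mul hn]; rwa [pow_succ] at hz
    rw [digitList, Nat.ofDigits_cons, ih h2, Nat.mod_add_div]

lemma digitList_ofDigits {n : ℕ} {l : List ℕ} (hl : ∀ a ∈ l, a < n) :
    digitList n l.length (Nat.ofDigits n l) = l := by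
  induction l with
  | nil => rfl
  | cons a l ih =>
    have ha : a < n := hl a (by simp)
    rw [List.length_cons, digitList, Nat.ofDigits_cons, Nat.add_mul_mod_self_left,
      Nat.mod_eq_of_lt ha, Nat.add_mul_div_left _ _ (by omega), Nat.div_eq_of_lt ha, zero_add,
      ih fun b hb => hl b (List.mem_cons_of_mem _ hb)]

lemma ofDigits_lt_pow_length {n : ℕ} {l : List ℕ} (hl : ∀ a ∈ l, a < n) :
    Nat.ofDigits n l < n ^ l.length := by
  induction l with
  | nil => simp
  | cons a l ih =>
    have ha : a < n := hl a (by simp)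
    have := ih fun b hb => hl b (List.mem_cons_of_mem _ hb)
    rw [List.length_cons, Nat.ofDigits_cons, pow_succ]
    nlinarith

lemma sum_range_mul_eq {α : Type*} [AddCommMonoid α] (f : ℕ → α) (a b : ℕ) :
    ∑ z ∈ Finset.range (a * b), f z =
      ∑ i ∈ Finset.range a, ∑ j ∈ Finset.range b, f (i * b + j) := by
  induction a with
  | zero => simp
  | succ a ih => rw [Finset.sum_range_succ, ← ih, add_mul, one_mul, Finset.sum_range_add]

/-! ### Complete subgraphs as increasing tuples -/

/-- The edges of a graph on `0, …, n - 1`, directed upwards, as a relation on natural numbers.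
The weak inequality is enough, since a graph has no loops. -/
def SimpleGraph.Ascends {n : ℕ} (G : SimpleGraph (Fin n)) (a b : ℕ) : Prop :=
  a ≤ b ∧ ∃ (ha : a < n) (hb : b < n), G.Adj ⟨a, ha⟩ ⟨b, hb⟩

/-- The digits of `z`, the lowest first, are the vertices of a complete subgraph on `m` vertices in
increasing order. -/
def SimpleGraph.IsCliqueCode {n : ℕ} (G : SimpleGraph (Fin n)) (m z : ℕ) : Prop :=
  (digitList n m z).Pairwise G.Ascends

lemma SimpleGraph.copyCount_completeGraph {V : Type*} [Fintype V] [DecidableEq V]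
    (G : SimpleGraph V) [DecidableRel G.Adj] (r : ℕ) :
    G.copyCount (SimpleGraph.completeGraph (Fin r)) = (G.cliqueFinset r).card := by
  classical
  rw [SimpleGraph.copyCount]
  have key : ∀ H : G.Subgraph, Nonempty (SimpleGraph.completeGraph (Fin r) ≃g H.coe) →
      ∀ a b, H.Adj a b ↔ a ∈ H.verts ∧ b ∈ H.verts ∧ a ≠ b := by
    rintro H ⟨e⟩ a b
    refine ⟨fun h => ⟨H.edge_vert h, H.edge_vert h.symm, h.ne⟩, fun ⟨ha, hb, hab⟩ => ?_⟩
    have h := e.symm.map_adj_iff (v := ⟨a, ha⟩) (w := ⟨b, hb⟩)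
    have : H.coe.Adj ⟨a, ha⟩ ⟨b, hb⟩ := by
      rw [← h]
      simpa using hab
    simpa using this
  refine Finset.card_bij (fun H _ => H.verts.toFinset) ?_ ?_ ?_
  · intro H hH
    have hH' := (Finset.mem_filter.1 hH).2
    obtain ⟨e⟩ := hH'
    rw [SimpleGraph.mem_cliqueFinset_iff, SimpleGraph.isNClique_iff]
    refine ⟨fun a ha b hb hab => ?_, ?_⟩
    · exact ((key H ⟨e⟩ a b).2 ⟨by simpa using ha, by simpa using hb, hab⟩).adj_sub
    · rw [Set.toFinset_card, ← Fintype.card_congr e.toEquiv, Fintype.card_fin]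
  · intro H hH K hK h
    have hv : H.verts = K.verts := Set.toFinset_inj.1 h
    ext a b
    · rw [hv]
    · rw [key H (Finset.mem_filter.1 hH).2, key K (Finset.mem_filter.1 hK).2, hv]
  · intro s hs
    rw [SimpleGraph.mem_cliqueFinset_iff, SimpleGraph.isNClique_iff] at hs
    refine ⟨(⊤ : G.Subgraph).induce s, ?_, by simp⟩
    simp only [Finset.mem_filter, Finset.mem_univ, true_and]
    refine ⟨⟨(Finset.equivFinOfCardEq hs.2).symm, ?_⟩⟩
    intro a b
    simp only [SimpleGraph.Subgraph.coe_adj, SimpleGraph.Subgraph.induce_adj,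
      SimpleGraph.Subgraph.top_adj, SimpleGraph.completeGraph, SimpleGraph.top_adj]
    refine ⟨fun h hab => h.2.2.ne (by rw [hab]), fun h => ⟨?_, ?_, hs.1 ?_ ?_ ?_⟩⟩
    any_goals exact ((Finset.equivFinOfCardEq hs.2).symm _).2
    exact fun h' => h ((Finset.equivFinOfCardEq hs.2).symm.injective (Subtype.ext h'))

open Classical in
/-- Listing the vertices of a complete subgraph in increasing order is a bijection onto the codes
below `n ^ r`. -/
lemma SimpleGraph.card_isCliqueCode {n : ℕ} (G : SimpleGraph (Fin n)) (r : ℕ) :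
    ((Finset.range (n ^ r)).filter (G.IsCliqueCode r)).card =
      G.copyCount (SimpleGraph.completeGraph (Fin r)) := by
  rw [SimpleGraph.copyCount_completeGraph]
  symm
  have hlt : ∀ s : Finset (Fin n), ∀ a ∈ (s.sort (· ≤ ·)).map Fin.val, a < n := by
    intro s a ha
    obtain ⟨b, -, rfl⟩ := List.mem_map.1 ha
    exact b.2
  refine Finset.card_bij (fun s _ => Nat.ofDigits n ((s.sort (· ≤ ·)).map Fin.val)) ?_ ?_ ?_
  · intro s hs
    rw [SimpleGraph.mem_cliqueFinset_iff, SimpleGraph.isNClique_iff] at hs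
    have hlen : ((s.sort (· ≤ ·)).map Fin.val).length = r := by simp [hs.2]
    have h1 := ofDigits_lt_pow_length (hlt s)
    have h2 := digitList_ofDigits (hlt s)
    rw [hlen] at h1 h2
    rw [Finset.mem_filter, Finset.mem_range]
    refine ⟨h1, ?_⟩
    rw [SimpleGraph.IsCliqueCode, h2, List.pairwise_map]
    refine List.Pairwise.imp_of_mem ?_ s.sortedLT_sort.pairwise
    intro a b ha hb hab
    exact ⟨hab.le, a.2, b.2, hs.1 (by simpa using ha) (by simpa using hb) hab.ne⟩
  · intro s hs t ht h
    rw [SimpleGraph.mem_cliqueFinset_iff, SimpleGraph.isNClique_iff] at hs ht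
    have h1 := digitList_ofDigits (hlt s)
    have h2 := digitList_ofDigits (hlt t)
    simp only [List.length_map, Finset.length_sort, hs.2, ht.2] at h1 h2
    have h3 : (s.sort (· ≤ ·)).map Fin.val = (t.sort (· ≤ ·)).map Fin.val := by
      rw [← h1, ← h2, h]
    have h4 := List.map_injective_iff.2 Fin.val_injective h3
    rw [← s.sort_toFinset (· ≤ ·), h4, Finset.sort_toFinset]
  · intro y hy
    rw [Finset.mem_filter, Finset.mem_range] at hy
    obtain ⟨hy, hc⟩ := hy
    have hmem : ∀ a ∈ digitList n r y, a < n := by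
      intro a ha
      refine lt_of_mem_digitList (Nat.pos_of_ne_zero ?_) ha
      rintro rfl
      cases r with
      | zero => simp [digitList] at ha
      | succ r => simp at hy
    obtain ⟨l, hl⟩ : ∃ l : List (Fin n), l.map Fin.val = digitList n r y :=
      ⟨(digitList n r y).pmap Fin.mk hmem, by simp [List.map_pmap]⟩
    rw [SimpleGraph.IsCliqueCode, ← hl, List.pairwise_map] at hc
    have hc' : l.Pairwise (fun a b => a < b ∧ G.Adj a b) := hc.imp fun {a b} h => by
      obtain ⟨h, _, _, h'⟩ := h
      exact ⟨lt_of_le_of_ne h h'.ne, h'⟩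
    have hnd : l.Nodup := hc'.imp fun h => h.1.ne
    have hsort : l.toFinset.sort (· ≤ ·) = l :=
      (List.toFinset_sort (· ≤ ·) hnd).2 (hc'.imp fun h => h.1.le)
    have hlen : l.length = r := by
      rw [← length_digitList n r y, ← hl, List.length_map]
    refine ⟨l.toFinset, ?_, ?_⟩
    · rw [SimpleGraph.mem_cliqueFinset_iff, SimpleGraph.isNClique_iff]
      refine ⟨?_, by rw [List.toFinset_card_of_nodup hnd, hlen]⟩
      have h := hc'.imp fun {a b} (h : a < b ∧ G.Adj a b) => h.2
      intro a ha b hb hab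
      have : Std.Symm G.Adj := ⟨fun _ _ h => h.symm⟩
      exact h.forall (by simpa using ha) (by simpa using hb) hab
    · rw [hsort, hl, ofDigits_digitList hy]

lemma SimpleGraph.IsCliqueCode.exists_copy {n : ℕ} {G : SimpleGraph (Fin n)} {m z : ℕ}
    (h : G.IsCliqueCode m z) (hn : 0 < n) :
    ∃ f : (SimpleGraph.completeGraph (Fin m)).Copy G,
      ∀ i : Fin m, ((f i : ℕ)) = (digitList n m z).getD i 0 := by
  have hget : ∀ i : Fin m, (digitList n m z).getD i 0 =
      (digitList n m z)[(i : ℕ)]'(by simp) := fun i => by simp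
  have hlt : ∀ i : Fin m, (digitList n m z).getD i 0 < n := fun i => by
    rw [hget]; exact lt_of_mem_digitList hn (List.getElem_mem _)
  have hadj : ∀ i j : Fin m, i < j →
      G.Adj ⟨_, hlt i⟩ ⟨_, hlt j⟩ := by
    intro i j hij
    obtain ⟨_, _, _, h⟩ := List.pairwise_iff_getElem.1 h i j (by simp) (by simp) hij
    simpa only [hget] using h
  have hadj' : ∀ i j : Fin m, i ≠ j →
      G.Adj ⟨_, hlt i⟩ ⟨_, hlt j⟩ := fun i j hij =>
    (lt_or_gt_of_ne hij).elim (hadj i j) fun h => (hadj j i h).symm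
  refine ⟨⟨⟨fun i => ⟨_, hlt i⟩, fun {i j} hij => hadj' i j (by simpa using hij)⟩, ?_⟩,
    fun i => rfl⟩
  intro i j hij
  by_contra hne
  exact (hadj' i j hne).ne hij

/-- A tuple in three parts `k`, `j`, `i` is an increasing complete subgraph as soon as any two of
the parts together are one. -/
lemma SimpleGraph.isCliqueCode_glue {n : ℕ} (G : SimpleGraph (Fin n)) {p q s i j k : ℕ}
    (hj : j < n ^ q) (hk : k < n ^ s) :
    G.IsCliqueCode (s + (q + p)) (k + n ^ s * (j + n ^ q * i)) ↔
      G.IsCliqueCode (q + p) (i * n ^ q + j) ∧ G.IsCliqueCode (s + q) (j * n ^ s + k) ∧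
        G.IsCliqueCode (s + p) (i * n ^ s + k) := by
  rw [show i * n ^ q + j = j + n ^ q * i by ring, show j * n ^ s + k = k + n ^ s * j by ring,
    show i * n ^ s + k = k + n ^ s * i by ring]
  simp only [SimpleGraph.IsCliqueCode, digitList_add _ _ hj, digitList_add _ _ hk,
    List.pairwise_append, List.mem_append]
  constructor
  · rintro ⟨h1, ⟨h2, h3, h4⟩, h5⟩
    exact ⟨⟨h2, h3, h4⟩, ⟨h1, h2, fun a ha b hb => h5 a ha b (.inl hb)⟩, h1, h3,
      fun a ha b hb => h5 a ha b (.inr hb)⟩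
  · rintro ⟨⟨h2, h3, h4⟩, ⟨h1, -, h5⟩, -, -, h6⟩
    exact ⟨h1, ⟨h2, h3, h4⟩, fun a ha b hb => hb.elim (h5 a ha b) (h6 a ha b)⟩

/-! ### Reasoning about programs -/

namespace WordRAM

variable {M M' : ℕ} {s : State}

lemma Expr.Fits.abs_le {e : Expr} (h : e.Fits M s) : |e.eval s| ≤ (M : ℤ) := by
  cases e with
  | const z => exact h
  | reg x => exact h
  | load a i => exact h.2
  | op o e f => exact h.2.2

lemma Expr.Fits.mono (hM : M ≤ M') {e : Expr} (h : e.Fits M s) : e.Fits M' s := by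
  have hM : (M : ℤ) ≤ M' := by exact_mod_cast hM
  induction e with
  | const z => exact le_trans h hM
  | reg x => exact le_trans h hM
  | load a i ih => exact ⟨ih h.1, h.2.trans hM⟩
  | op o e f ihe ihf => exact ⟨ihe h.1, ihf h.2.1, h.2.2.trans hM⟩

lemma Exec.mono (hM : M ≤ M') {P : Prog} {s s' : State} {t : ℕ} (h : Exec M P s t s') :
    Exec M' P s t s' := by
  induction h with
  | skip s => exact .skip s
  | assign s x e he => exact .assign s x e (he.mono hM)
  | store s a i e hi he => exact .store s a i e (hi.mono hM) (he.mono hM)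
  | seq P Q s s' s'' t t' _ _ ihP ihQ => exact .seq _ _ _ _ _ _ _ ihP ihQ
  | ite_true e P Q s s' t he h _ ih => exact .ite_true _ _ _ _ _ _ (he.mono hM) h ih
  | ite_false e P Q s s' t he h _ ih => exact .ite_false _ _ _ _ _ _ (he.mono hM) h ih
  | while_true e P s s' s'' t t' he h _ _ ihP ihW =>
    exact .while_true _ _ _ _ _ _ _ (he.mono hM) h ihP ihW
  | while_false e P s he h => exact .while_false _ _ _ (he.mono hM) h

/-- The expression evaluates to the natural number `v`, within the word size. -/
def Expr.Computes (M : ℕ) (s : State) (e : Expr) (v : ℕ) : Prop :=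
  e.Fits M s ∧ e.eval s = v

namespace Expr.Computes

variable {e f : Expr} {u v : ℕ}

lemma congr (h : e.Computes M s u) (huv : u = v) : e.Computes M s v := huv ▸ h

lemma le (h : e.Computes M s v) : v ≤ M := by
  have := h.1.abs_le
  rw [h.2, Nat.abs_cast] at this
  exact_mod_cast this

lemma const (h : v ≤ M) : (Expr.const v).Computes M s v :=
  ⟨by simpa [Expr.Fits] using h, rfl⟩

lemma reg {x : ℕ} (hx : s.reg x = v) (h : v ≤ M) : (Expr.reg x).Computes M s v :=
  ⟨by simpa [Expr.Fits, hx] using h, hx⟩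

lemma load {a : ℕ} (he : e.Computes M s u) (hv : s.arr a u = v) (h : v ≤ M) :
    (Expr.load a e).Computes M s v := by
  have h' : s.arr a (e.eval s) = v := by rw [he.2, hv]
  exact ⟨⟨he.1, by rw [h', Nat.abs_cast]; exact_mod_cast h⟩, h'⟩

lemma op {o : Op} {w : ℕ} (he : e.Computes M s u) (hf : f.Computes M s v)
    (ho : o.eval u v = w) (h : w ≤ M) : (Expr.op o e f).Computes M s w := by
  have h' : o.eval (e.eval s) (f.eval s) = w := by rw [he.2, hf.2, ho]
  exact ⟨⟨he.1, hf.1, by rw [h', Nat.abs_cast]; exact_mod_cast h⟩, h'⟩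

lemma add (he : e.Computes M s u) (hf : f.Computes M s v) (h : u + v ≤ M) :
    (Expr.op .add e f).Computes M s (u + v) := op he hf (by simp [Op.eval]) h

lemma mul (he : e.Computes M s u) (hf : f.Computes M s v) (h : u * v ≤ M) :
    (Expr.op .mul e f).Computes M s (u * v) := op he hf (by simp [Op.eval]) h

lemma div (he : e.Computes M s u) (hf : f.Computes M s v) :
    (Expr.op .div e f).Computes M s (u / v) :=
  op he hf (by simp [Op.eval]) ((Nat.div_le_self _ _).trans he.le)

lemma mod (he : e.Computes M s u) (hf : f.Computes M s v) :
    (Expr.op .mod e f).Computes M s (u % v) :=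
  op he hf (by simp [Op.eval]) ((Nat.mod_le _ _).trans he.le)

end Expr.Computes

/-- Total correctness with a time bound: started in `s`, the program `P` halts within `T` steps in a
memory that satisfies `Q`. -/
def Halts (M : ℕ) (P : Prog) (s : State) (T : ℕ) (Q : State → Prop) : Prop :=
  ∃ (t : ℕ) (s' : State), Exec M P s t s' ∧ t ≤ T ∧ Q s'

namespace Halts

variable {P P' : Prog} {T T' : ℕ} {Q Q' : State → Prop}

lemma mono (h : Halts M P s T Q) (hT : T ≤ T') (hQ : ∀ s', Q s' → Q' s') : Halts M P s T' Q' := by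
  obtain ⟨t, s', h, ht, hs'⟩ := h
  exact ⟨t, s', h, ht.trans hT, hQ s' hs'⟩

lemma seq (h : Halts M P s T Q) (h' : ∀ s', Q s' → Halts M P' s' T' Q') :
    Halts M (.seq P P') s (T + T') Q' := by
  obtain ⟨t, s', h, ht, hs'⟩ := h
  obtain ⟨t', s'', h'', ht', hs''⟩ := h' s' hs'
  exact ⟨_, _, .seq _ _ _ _ _ _ _ h h'', add_le_add ht ht', hs''⟩

lemma assign {x : ℕ} {e : Expr} (he : e.Fits M s) (hQ : Q (s.setReg x (e.eval s))) :
    Halts M (.assign x e) s (e.cost + 1) Q :=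
  ⟨_, _, .assign _ _ _ he, le_rfl, hQ⟩

lemma store {a : ℕ} {i e : Expr} (hi : i.Fits M s) (he : e.Fits M s)
    (hQ : Q (s.setArr a (i.eval s) (e.eval s))) :
    Halts M (.store a i e) s (i.cost + e.cost + 1) Q :=
  ⟨_, _, .store _ _ _ _ hi he, le_rfl, hQ⟩

end Halts

@[simp] lemma State.reg_setReg (s : State) (x y : ℕ) (v : ℤ) :
    (s.setReg x v).reg y = if y = x then v else s.reg y := by
  simp [State.setReg, Function.update_apply]

@[simp] lemma State.arr_setReg (s : State) (x : ℕ) (v : ℤ) : (s.setReg x v).arr = s.arr := rfl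

@[simp] lemma State.reg_setArr (s : State) (a : ℕ) (i v : ℤ) : (s.setArr a i v).reg = s.reg := rfl

lemma State.arr_setArr (s : State) (a b : ℕ) (i v : ℤ) :
    (s.setArr a i v).arr b = if b = a then Function.update (s.arr a) i v else s.arr b := by
  simp [State.setArr, Function.update_apply]

/-- The loop that runs `P` with the values `N - 1, …, 1, 0` of register `i`, where `N` is the value
of register `i` at the start. -/
def Prog.countdown (i : ℕ) (P : Prog) : Prog :=
  .while (.reg i) (.seq (.assign i (.op .sub (.reg i) (.const 1))) P)

lemma Halts.countdown {i N C : ℕ} {P : Prog} (I : ℕ → State → Prop) (hN : N ≤ M)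
    (hreg : ∀ k s, I k s → s.reg i = k)
    (hstep : ∀ k < N, ∀ s, I (k + 1) s → Halts M P (s.setReg i k) C (I k)) (hI : I N s) :
    Halts M (.countdown i P) s (N * (C + 6) + 2) (I 0) := by
  induction N generalizing s with
  | zero =>
    have h := hreg _ _ hI
    exact ⟨_, s, .while_false _ _ _ (by simp [Expr.Fits, h]) (by simp [Expr.eval, h]),
      by simp [Expr.cost], hI⟩
  | succ k ih =>
    have h := hreg _ _ hI
    have hM : ((k : ℤ) + 1) ≤ M := by exact_mod_cast hN
    obtain ⟨t, s', h1, ht, hI'⟩ := hstep k (by omega) s hI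
    obtain ⟨t', s'', h2, ht', hI''⟩ := ih (by omega) (fun j hj => hstep j (by omega)) hI'
    have ha : Exec M (.assign i (.op .sub (.reg i) (.const 1))) s 4 (s.setReg i k) := by
      have h3 : (Expr.op .sub (.reg i) (.const 1)).eval s = (k : ℤ) := by
        simp [Expr.eval, Op.eval, h]
      rw [← h3]
      refine .assign _ _ _ ⟨?_, ?_, ?_⟩
      · simp only [Expr.Fits, h, Nat.abs_cast]; exact_mod_cast hN
      · simp only [Expr.Fits, abs_one]; omega
      · simp only [Expr.eval, Op.eval, h, abs_le]; push_cast; omega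
    refine ⟨_, s'', .while_true _ _ _ _ _ _ _ ?_ ?_ (.seq _ _ _ _ _ _ _ ha h1) h2, ?_, hI''⟩
    · simp only [Expr.Fits, h, Nat.abs_cast]; exact_mod_cast hN
    · simp only [Expr.eval, h]; norm_cast
    · simp only [Expr.cost]; linarith

/-- The program that writes the values of `e` for `0, …, N - 1` in register `i` into the cells
`0, …, N - 1` of the array `a`, where `N` is the value of `eN`. -/
def Prog.fill (i a : ℕ) (eN e : Expr) : Prog :=
  .seq (.assign i eN) (.countdown i (.store a (.reg i) e))

lemma Halts.fill {i a N : ℕ} {eN e : Expr} {f : ℕ → ℕ} (hN : eN.Computes M s N)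
    (ha : s.arr a = fun _ => 0)
    (he : ∀ k < N, ∀ s' : State, (∀ y ≠ i, s'.reg y = s.reg y) → (∀ b ≠ a, s'.arr b = s.arr b) →
      s'.reg i = k → e.Computes M s' (f k)) :
    Halts M (.fill i a eN e) s (eN.cost + 1 + (N * (1 + e.cost + 1 + 6) + 2)) fun s' =>
      (∀ y ≠ i, s'.reg y = s.reg y) ∧ (∀ b ≠ a, s'.arr b = s.arr b) ∧
        s'.arr a = fun w : ℤ => if 0 ≤ w ∧ w < N then (f w.toNat : ℤ) else 0 := by
  let I : ℕ → State → Prop := fun k s' =>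
    s'.reg i = k ∧ (∀ y ≠ i, s'.reg y = s.reg y) ∧ (∀ b ≠ a, s'.arr b = s.arr b) ∧
        s'.arr a = fun w : ℤ => if k ≤ w ∧ w < N then (f w.toNat : ℤ) else 0
  refine Halts.seq (Q := I N) (Halts.assign hN.1 ?_) fun s' hs' => ?_
  · refine ⟨by simp [hN.2], fun y hy => by simp [hy], fun b _ => rfl, ?_⟩
    funext w
    rw [if_neg (by omega)]
    simp [ha]
  · refine (Halts.countdown I hN.le (fun k s h => h.1) ?_ hs').mono le_rfl fun s'' h =>
      ⟨h.2.1, h.2.2.1, by simpa using h.2.2.2⟩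
    rintro k hk s1 ⟨-, h2, h3, h4⟩
    have hc := he k hk (s1.setReg i k) (fun y hy => by simp [hy, h2 y hy])
      (fun b hb => h3 b hb) (by simp)
    have hi : (Expr.reg i).Computes M (s1.setReg i k) k := .reg (by simp) (hk.le.trans hN.le)
    refine Halts.store hi.1 hc.1 ⟨by simp, fun y hy => by simp [hy, h2 y hy], fun b hb => ?_, ?_⟩
    · rw [State.arr_setArr, if_neg hb]
      exact h3 b hb
    · funext w
      rw [State.arr_setArr, if_pos rfl, hi.2, hc.2, State.arr_setReg, h4, Function.update_apply]
      by_cases hw : w = k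
      · subst hw
        simp [hk]
      · rw [if_neg hw]
        refine if_congr ?_ rfl rfl
        push_cast
        omega

/-- The program that adds the values of `e` for `0, …, N - 1` in register `i` to register `x`. -/
def Prog.sumUp (i x : ℕ) (eN e : Expr) : Prog :=
  .seq (.assign i eN) (.countdown i (.assign x (.op .add (.reg x) e)))

lemma Halts.sumUp {i x N : ℕ} {eN e : Expr} {f : ℕ → ℕ} (hix : x ≠ i) (hN : eN.Computes M s N)
    (hx : s.reg x = 0) (hM : ∑ z ∈ Finset.range N, f z ≤ M)
    (he : ∀ k < N, ∀ s' : State, (∀ y, y ≠ i → y ≠ x → s'.reg y = s.reg y) → s'.arr = s.arr →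
      s'.reg i = k → e.Computes M s' (f k)) :
    Halts M (.sumUp i x eN e) s (eN.cost + 1 + (N * (1 + e.cost + 1 + 1 + 6) + 2)) fun s' =>
      s'.reg x = (∑ z ∈ Finset.range N, f z : ℕ) := by
  let I : ℕ → State → Prop := fun k s' =>
    s'.reg i = k ∧ (∀ y, y ≠ i → y ≠ x → s'.reg y = s.reg y) ∧ s'.arr = s.arr ∧
      ∃ v : ℕ, s'.reg x = v ∧ v + ∑ z ∈ Finset.range k, f z = ∑ z ∈ Finset.range N, f z
  refine Halts.seq (Q := I N) (Halts.assign hN.1 ?_) fun s' hs' => ?_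
  · exact ⟨by simp [hN.2], fun y hy _ => by simp [hy], rfl, 0, by simp [hix, hx], zero_add _⟩
  · refine (Halts.countdown I hN.le (fun k s h => h.1) ?_ hs').mono le_rfl fun s'' h => ?_
    · rintro k hk s1 ⟨-, h2, h3, v, h4, h5⟩
      rw [Finset.sum_range_succ] at h5
      have hc := he k hk (s1.setReg i k) (fun y hy hy' => by simp [hy, h2 y hy hy'])
        h3 (by simp)
      have hi : (Expr.reg x).Computes M (s1.setReg i k) v := .reg (by simp [hix, h4]) (by omega)
      have ha := hi.add hc (by omega)
      refine (Halts.assign ha.1 ⟨by simp [hix.symm], fun y hy hy' => by simp [hy, hy', h2 y hy hy'],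
        h3, v + f k, by simp [ha.2], by omega⟩).mono (by simp only [Expr.cost]; omega) fun _ h => h
    · obtain ⟨-, -, -, v, h4, h5⟩ := h
      rw [h4, ← h5]
      simp

/-- The program that looks for a number below `N` for which, when it is in register `i`, the value
of `e` is nonzero, and leaves it in register `x`. -/
def Prog.search (i x : ℕ) (eN e : Expr) : Prog :=
  .seq (.assign i eN) (.countdown i (.ite e (.assign x (.reg i)) .skip))

lemma Halts.search {i x N : ℕ} {eN e : Expr} {f : ℕ → ℕ} (hix : x ≠ i) (hN : eN.Computes M s N)
    (hf : ∃ z < N, f z ≠ 0)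
    (he : ∀ k < N, ∀ s' : State, (∀ y, y ≠ i → y ≠ x → s'.reg y = s.reg y) → s'.arr = s.arr →
      s'.reg i = k → e.Computes M s' (f k)) :
    Halts M (.search i x eN e) s (eN.cost + 1 + (N * (e.cost + 1 + 2 + 6) + 2)) fun s' =>
      (∀ y, y ≠ i → y ≠ x → s'.reg y = s.reg y) ∧ s'.arr = s.arr ∧
        ∃ z < N, f z ≠ 0 ∧ s'.reg x = z := by
  let I : ℕ → State → Prop := fun k s' =>
    s'.reg i = k ∧ (∀ y, y ≠ i → y ≠ x → s'.reg y = s.reg y) ∧ s'.arr = s.arr ∧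
      ((∃ z < N, f z ≠ 0 ∧ s'.reg x = z) ∨ ∃ z < k, f z ≠ 0)
  refine Halts.seq (Q := I N) (Halts.assign hN.1 ?_) fun s' hs' => ?_
  · exact ⟨by simp [hN.2], fun y hy _ => by simp [hy], rfl, .inr hf⟩
  · refine (Halts.countdown I hN.le (fun k s h => h.1) ?_ hs').mono le_rfl fun s'' h =>
      ⟨h.2.1, h.2.2.1, h.2.2.2.resolve_right (by simp)⟩
    rintro k hk s1 ⟨-, h2, h3, h4⟩
    have hc := he k hk (s1.setReg i k) (fun y hy hy' => by simp [hy, h2 y hy hy'])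
      h3 (by simp)
    have hi : (Expr.reg i).Computes M (s1.setReg i k) k := .reg (by simp) (hk.le.trans hN.le)
    by_cases hfk : f k = 0
    · refine ⟨_, _, .ite_false _ _ _ _ _ _ hc.1 (by rw [hc.2, hfk]; rfl) (.skip _), by omega,
        by simp, fun y hy hy' => by simp [hy, h2 y hy hy'], h3, ?_⟩
      refine h4.imp (fun ⟨z, hz, h, h'⟩ => ⟨z, hz, h, by simp [hix, h']⟩) fun ⟨z, hz, h⟩ =>
        ⟨z, ?_, h⟩
      refine lt_of_le_of_ne (Nat.le_of_lt_succ hz) ?_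
      rintro rfl
      exact h hfk
    · refine ⟨_, _, .ite_true _ _ _ _ _ _ hc.1 (by rw [hc.2]; exact_mod_cast hfk)
        (.assign _ _ _ hi.1), by simp [Expr.cost], ?_⟩
      rw [hi.2]
      exact ⟨by simp [hix.symm], fun y hy hy' => by simp [hy, hy', h2 y hy hy'], h3,
        .inl ⟨k, hk, hfk, by simp⟩⟩

/-! ### Subroutines and a lower bound for the time -/

/-- The expression with all registers renumbered by `R` and all arrays by `K`. -/
def Expr.shift (R K : ℕ) : Expr → Expr
  | .const z => .const z
  | .reg x => .reg (x + R)
  | .load a i => .load (a + K) (i.shift R K)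
  | .op o e f => .op o (e.shift R K) (f.shift R K)

/-- The program with all registers renumbered by `R` and all arrays by `K`, for use as a subroutine
of a program with registers below `R` and arrays below `K`. -/
def Prog.shift (R K : ℕ) : Prog → Prog
  | .skip => .skip
  | .assign x e => .assign (x + R) (e.shift R K)
  | .store a i e => .store (a + K) (i.shift R K) (e.shift R K)
  | .seq P Q => .seq (P.shift R K) (Q.shift R K)
  | .ite e P Q => .ite (e.shift R K) (P.shift R K) (Q.shift R K)
  | .while e P => .while (e.shift R K) (P.shift R K)

/-- The memory `s` is the part of `σ` that starts at register `R` and array `K`. -/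
def State.ShiftsTo (R K : ℕ) (s σ : State) : Prop :=
  (∀ x, σ.reg (x + R) = s.reg x) ∧ ∀ a, σ.arr (a + K) = s.arr a

section shift

variable {R K : ℕ} {σ : State}

@[simp] lemma Expr.cost_shift (e : Expr) : (e.shift R K).cost = e.cost := by
  induction e with
  | const z => rfl
  | reg x => rfl
  | load a i ih => simp [Expr.shift, Expr.cost, ih]
  | op o e f ihe ihf => simp [Expr.shift, Expr.cost, ihe, ihf]

lemma Expr.eval_shift (h : s.ShiftsTo R K σ) (e : Expr) : (e.shift R K).eval σ = e.eval s := by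
  induction e with
  | const z => rfl
  | reg x => exact h.1 x
  | load a i ih => simp [Expr.shift, Expr.eval, ih, h.2]
  | op o e f ihe ihf => simp [Expr.shift, Expr.eval, ihe, ihf]

lemma Expr.Fits.shift (h : s.ShiftsTo R K σ) {e : Expr} (he : e.Fits M s) :
    (e.shift R K).Fits M σ := by
  induction e with
  | const z => exact he
  | reg x => simpa [Expr.shift, Expr.Fits, h.1] using he
  | load a i ih => exact ⟨ih he.1, by rw [h.2, Expr.eval_shift h]; exact he.2⟩
  | op o e f ihe ihf =>
    exact ⟨ihe he.1, ihf he.2.1, by rw [Expr.eval_shift h, Expr.eval_shift h]; exact he.2.2⟩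

lemma Exec.shift {P : Prog} {s s' : State} {t : ℕ} (hP : Exec M P s t s')
    (h : s.ShiftsTo R K σ) :
    ∃ σ', Exec M (P.shift R K) σ t σ' ∧ s'.ShiftsTo R K σ' ∧ (∀ x < R, σ'.reg x = σ.reg x) ∧
      ∀ a < K, σ'.arr a = σ.arr a := by
  induction hP generalizing σ with
  | skip s => exact ⟨σ, .skip σ, h, fun _ _ => rfl, fun _ _ => rfl⟩
  | assign s x e he =>
    have h1 := Exec.assign σ (x + R) _ (he.shift h)
    rw [Expr.cost_shift, Expr.eval_shift h] at h1
    refine ⟨_, h1, ⟨fun y => ?_, h.2⟩, fun y hy => ?_, fun _ _ => rfl⟩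
    · simp [h.1]
    · simp [show y ≠ x + R by omega]
  | store s a i e hi he =>
    have h1 := Exec.store σ (a + K) _ _ (hi.shift h) (he.shift h)
    rw [Expr.cost_shift, Expr.cost_shift, Expr.eval_shift h, Expr.eval_shift h] at h1
    refine ⟨_, h1, ⟨h.1, fun b => ?_⟩, fun _ _ => rfl, fun b hb => ?_⟩
    · simp [State.arr_setArr, h.2]
    · simp [State.arr_setArr, show b ≠ a + K by omega]
  | seq P Q s s' s'' t t' _ _ ihP ihQ =>
    obtain ⟨σ', h1, h2, h3, h4⟩ := ihP h
    obtain ⟨σ'', h1', h2', h3', h4'⟩ := ihQ h2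
    exact ⟨σ'', .seq _ _ _ _ _ _ _ h1 h1', h2', fun x hx => (h3' x hx).trans (h3 x hx),
      fun a ha => (h4' a ha).trans (h4 a ha)⟩
  | ite_true e P Q s s' t he he' _ ih =>
    obtain ⟨σ', h1, h2⟩ := ih h
    have h3 := Exec.ite_true _ _ (Q.shift R K) _ _ _ (he.shift h)
      (by rwa [Expr.eval_shift h]) h1
    rw [Expr.cost_shift] at h3
    exact ⟨σ', h3, h2⟩
  | ite_false e P Q s s' t he he' _ ih =>
    obtain ⟨σ', h1, h2⟩ := ih h
    have h3 := Exec.ite_false _ (P.shift R K) _ _ _ _ (he.shift h)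
      (by rwa [Expr.eval_shift h]) h1
    rw [Expr.cost_shift] at h3
    exact ⟨σ', h3, h2⟩
  | while_true e P s s' s'' t t' he he' _ _ ihP ihW =>
    obtain ⟨σ', h1, h2, h3, h4⟩ := ihP h
    obtain ⟨σ'', h1', h2', h3', h4'⟩ := ihW h2
    have h5 := Exec.while_true _ _ _ _ _ _ _ (he.shift h) (by rwa [Expr.eval_shift h]) h1 h1'
    rw [Expr.cost_shift] at h5
    exact ⟨σ'', h5, h2', fun x hx => (h3' x hx).trans (h3 x hx),
      fun a ha => (h4' a ha).trans (h4 a ha)⟩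
  | while_false e P s he he' =>
    have h1 := Exec.while_false _ (P.shift R K) _ (he.shift h) (by rwa [Expr.eval_shift h])
    rw [Expr.cost_shift] at h1
    exact ⟨σ, h1, h, fun _ _ => rfl, fun _ _ => rfl⟩

lemma Halts.shift {P : Prog} {T : ℕ} {Q : State → Prop} (hP : Halts M P s T Q)
    (h : s.ShiftsTo R K σ) :
    Halts M (P.shift R K) σ T fun σ' => (∃ s', s'.ShiftsTo R K σ' ∧ Q s') ∧
      (∀ x < R, σ'.reg x = σ.reg x) ∧ ∀ a < K, σ'.arr a = σ.arr a := by
  obtain ⟨t, s', h1, ht, hQ⟩ := hP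
  obtain ⟨σ', h2, h3, h4⟩ := h1.shift h
  exact ⟨t, σ', h2, ht, ⟨s', h3, hQ⟩, h4⟩

end shift

/-- A run of `t` steps changes at most `t` cells of an array. -/
lemma Exec.exists_card_le {P : Prog} {s s' : State} {t : ℕ} (h : Exec M P s t s') (a : ℕ) :
    ∃ F : Finset ℤ, F.card ≤ t ∧ ∀ z ∉ F, s'.arr a z = s.arr a z := by
  induction h with
  | skip s => exact ⟨∅, by simp, fun _ _ => rfl⟩
  | assign s x e he => exact ⟨∅, by simp, fun _ _ => rfl⟩
  | store s b i e hi he =>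
    refine ⟨{i.eval s}, by simp, fun z hz => ?_⟩
    rw [State.arr_setArr]
    split_ifs with hab
    · subst hab
      rw [Function.update_of_ne (by simpa using hz)]
    · rfl
  | seq P Q s s' s'' t t' _ _ ihP ihQ =>
    obtain ⟨F, hF, h⟩ := ihP
    obtain ⟨F', hF', h'⟩ := ihQ
    refine ⟨F ∪ F', (Finset.card_union_le _ _).trans (by omega), fun z hz => ?_⟩
    rw [Finset.mem_union, not_or] at hz
    rw [h' z hz.2, h z hz.1]
  | ite_true e P Q s s' t he he' _ ih =>
    obtain ⟨F, hF, h⟩ := ih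
    exact ⟨F, by omega, h⟩
  | ite_false e P Q s s' t he he' _ ih =>
    obtain ⟨F, hF, h⟩ := ih
    exact ⟨F, by omega, h⟩
  | while_true e P s s' s'' t t' he he' _ _ ihP ihW =>
    obtain ⟨F, hF, h⟩ := ihP
    obtain ⟨F', hF', h'⟩ := ihW
    refine ⟨F ∪ F', (Finset.card_union_le _ _).trans (by omega), fun z hz => ?_⟩
    rw [Finset.mem_union, not_or] at hz
    rw [h' z hz.2, h z hz.1]
  | while_false e P s he he' => exact ⟨∅, by simp, fun _ _ => rfl⟩

end WordRAM

/-! ### Matrices in memory -/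

namespace WordRAM

/-- The contents of an array with `f 0, …, f (N - 1)` in its first `N` cells and zeros elsewhere. -/
def cells (N : ℕ) (f : ℕ → ℤ) (w : ℤ) : ℤ := if 0 ≤ w ∧ w < N then f w.toNat else 0

lemma cells_of_lt {N z : ℕ} {f : ℕ → ℤ} (hz : z < N) : cells N f z = f z := by
  rw [cells, if_pos ⟨by omega, by omega⟩, Int.toNat_natCast]

lemma rowMajor_apply {a b : ℕ} (A : Matrix (Fin a) (Fin b) ℤ) (i : Fin a) (j : Fin b) :
    rowMajor A ((i : ℤ) * b + j) = A i j := by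
  have key : ∀ (i' : Fin a) (j' : Fin b),
      (i : ℤ) * b + j = (i' : ℤ) * b + j' → i = i' ∧ j = j' := by
    intro i' j' h
    have h' : (i : ℕ) * b + j = (i' : ℕ) * b + j' := by exact_mod_cast h
    have hb : 0 < b := j.pos
    have h1 := congrArg (· % b) h'
    have h2 := congrArg (· / b) h'
    simp only [Nat.mul_add_mod_self_right, Nat.mod_eq_of_lt j.2, Nat.mod_eq_of_lt j'.2] at h1
    simp only [mul_comm _ b, Nat.mul_add_div hb, Nat.div_eq_of_lt j.2, Nat.div_eq_of_lt j'.2,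
      add_zero] at h2
    exact ⟨Fin.ext h2, Fin.ext h1⟩
  rw [rowMajor, Finset.sum_eq_single i, Finset.sum_eq_single j, if_pos rfl]
  · exact fun j' _ hj' => if_neg fun h => hj' (key _ _ h).2.symm
  · exact fun h => absurd (Finset.mem_univ _) h
  · exact fun i' _ hi' => Finset.sum_eq_zero fun j' _ =>
      if_neg fun h => hi' (key _ _ h).1.symm
  · exact fun h => absurd (Finset.mem_univ _) h

lemma rowMajor_eq_cells (a b : ℕ) (f : ℕ → ℤ) :
    rowMajor (Matrix.of fun (i : Fin a) (j : Fin b) => f (i * b + j)) = cells (a * b) f := by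
  funext w
  by_cases hw : 0 ≤ w ∧ w < (a * b : ℕ)
  · lift w to ℕ using hw.1
    have hw' : w < a * b := by exact_mod_cast hw.2
    have hb : 0 < b := Nat.pos_of_ne_zero fun h => by simp [h] at hw'
    have h := rowMajor_apply (Matrix.of fun (i : Fin a) (j : Fin b) => f (i * b + j))
      ⟨w / b, (Nat.div_lt_iff_lt_mul hb).2 hw'⟩ ⟨w % b, Nat.mod_lt _ hb⟩
    rw [cells_of_lt hw']
    simp only [Matrix.of_apply] at h
    rw [Nat.div_add_mod'] at h
    rw [← h]
    congr 1
    exact_mod_cast (Nat.div_add_mod' w b).symm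
  · rw [cells, if_neg hw, rowMajor]
    refine Finset.sum_eq_zero fun i _ => Finset.sum_eq_zero fun j _ => if_neg ?_
    rintro rfl
    refine hw ⟨by positivity, ?_⟩
    have h1 : ((i : ℕ) + 1) * b ≤ a * b := Nat.mul_le_mul_right _ i.2
    have h2 := j.2
    exact_mod_cast (by nlinarith : (i : ℕ) * b + j < a * b)

lemma abs_rowMajor_le {a b : ℕ} {A : Matrix (Fin a) (Fin b) ℤ} {D : ℤ} (hD : 0 ≤ D)
    (hA : ∀ i j, |A i j| ≤ D) (z : ℤ) : |rowMajor A z| ≤ D := by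
  by_cases h : ∃ (i : Fin a) (j : Fin b), z = (i : ℤ) * b + j
  · obtain ⟨i, j, rfl⟩ := h
    rw [rowMajor_apply]
    exact hA i j
  · push Not at h
    have h0 : rowMajor A z = 0 :=
      Finset.sum_eq_zero fun i _ => Finset.sum_eq_zero fun j _ => if_neg (h i j)
    rw [h0, abs_zero]
    exact hD

end WordRAM

lemma powDim_natCast (n k : ℕ) : powDim n k = n ^ k := by
  rw [powDim, Real.rpow_natCast, ← Nat.cast_pow, Nat.floor_natCast]

/-- On words bounded by `M`, the program `P` multiplies all `a × b` by `b × c` matrices with entries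
`0` and `1` within `T` steps. -/
def MultipliesBits (P : Prog) (M T a b c : ℕ) : Prop :=
  ∀ f g : ℕ → ℕ, (∀ z, f z ≤ 1) → (∀ z, g z ≤ 1) →
    Halts M P (initial [(a : ℤ), (b : ℤ), (c : ℤ)]
      [cells (a * b) fun z => f z, cells (b * c) fun z => g z]) T fun s' =>
        ∀ i < a, ∀ k < c, s'.arr 2 ((i * c + k : ℕ) : ℤ) =
          (∑ j ∈ Finset.range b, f (i * b + j) * g (j * c + k) : ℕ)

/-- A program that multiplies rectangular matrices takes at least `n ^ (p + s)` steps, since the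
product of two matrices with all entries `1` has no zero entry. -/
lemma MatMulInTime.exists_multipliesBits {p q s : ℕ} {τ : ℝ} (h : MatMulInTime p q s τ) :
    ∃ (P : Prog) (t M : ℕ → ℕ) (k : ℕ),
      (fun n => (t n : ℝ)) =O[Filter.atTop] (fun n : ℕ => (n : ℝ) ^ τ) ∧
      (fun n => (M n : ℝ)) =O[Filter.atTop] (fun n : ℕ => (n : ℝ) ^ k) ∧
      (∀ n, 0 < n → n ^ (p + s) ≤ t n) ∧
      ∀ n, MultipliesBits P (M n) (t n) (n ^ p) (n ^ q) (n ^ s) := by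
  obtain ⟨P, hP⟩ := h
  obtain ⟨t, M, k, ht, hM, hx⟩ := hP 0
  have key : ∀ n, MultipliesBits P (M n) (t n) (n ^ p) (n ^ q) (n ^ s) := by
    intro n f g hf hg
    obtain ⟨r, s', h1, h2, h3⟩ := hx
      { n := n
        A := Matrix.of fun i j => ((f (i * powDim n q + j) : ℕ) : ℤ)
        B := Matrix.of fun i j => ((g (i * powDim n s + j) : ℕ) : ℤ)
        hA := fun i j => by simpa using hf _
        hB := fun i j => by simpa using hg _ }
    refine ⟨r, s', ?_, h2, fun i hi k hk => ?_⟩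
    · simp only [matMulProblem] at h1
      rw [rowMajor_eq_cells _ _ fun z => (f z : ℤ), rowMajor_eq_cells _ _ fun z => (g z : ℤ)] at h1
      simpa only [powDim_natCast] using h1
    · have h4 := h3 ⟨i, by rwa [powDim_natCast]⟩ ⟨k, by rwa [powDim_natCast]⟩
      simp only [Matrix.mul_apply, Matrix.of_apply] at h4
      rw [Fin.sum_univ_eq_sum_range
        fun j => (f (i * powDim n q + j) : ℤ) * (g (j * powDim n s + k) : ℤ)] at h4
      simp only [powDim_natCast] at h4
      push_cast at h4 ⊢
      exact h4
  refine ⟨P, t, M, k, ht, hM, fun n hn => ?_, key⟩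
  obtain ⟨r, s', h1, h2, h3⟩ := key n (fun _ => 1) (fun _ => 1) (fun _ => le_rfl) fun _ => le_rfl
  obtain ⟨F, hF, hF'⟩ := h1.exists_card_le 2
  have hsub : (Finset.range (n ^ (p + s))).map Nat.castEmbedding ⊆ F := by
    intro w hw
    obtain ⟨z, hz, rfl⟩ := Finset.mem_map.1 hw
    rw [Finset.mem_range, pow_add] at hz
    by_contra hzF
    have h4 := hF' _ hzF
    have h5 := h3 (z / n ^ s) ((Nat.div_lt_iff_lt_mul (by positivity)).2 hz) (z % n ^ s)
      (Nat.mod_lt _ (by positivity))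
    rw [Nat.div_add_mod'] at h5
    rw [Nat.castEmbedding_apply, h5] at h4
    simp [initial, hn.ne'] at h4
  have := Finset.card_le_card hsub
  rw [Finset.card_map, Finset.card_range] at this
  omega

/-! ### Multiplication by the definition -/

namespace WordRAM

/-- Multiplication by the definition, in a single loop: for `z` below `a * b * c`, term number
`z % b` of the inner product for the cell `z / b` is added to that cell. -/
def naiveMul : Prog :=
  let w : Expr := .op .div (.reg 3) (.reg 1)
  let j : Expr := .op .mod (.reg 3) (.reg 1)
  .seq (.assign 3 (.op .mul (.op .mul (.reg 0) (.reg 2)) (.reg 1)))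
    (.countdown 3 (.store 2 w (.op .add (.load 2 w) (.op .mul
      (.load 0 (.op .add (.op .mul (.op .div w (.reg 2)) (.reg 1)) j))
      (.load 1 (.op .add (.op .mul j (.reg 2)) (.op .mod w (.reg 2))))))))

lemma halts_addMul {M u x y C : ℕ} {s : State} {w i j : Expr} {Q : State → Prop}
    (hw : w.Computes M s u) (hi : i.Computes M s x) (hj : j.Computes M s y)
    (h2 : |s.arr 2 u| ≤ (M : ℤ)) (h0 : |s.arr 0 x| ≤ (M : ℤ)) (h1 : |s.arr 1 y| ≤ (M : ℤ))
    (h01 : |s.arr 0 x * s.arr 1 y| ≤ (M : ℤ))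
    (h : |s.arr 2 u + s.arr 0 x * s.arr 1 y| ≤ (M : ℤ))
    (hC : 2 * w.cost + i.cost + j.cost + 6 ≤ C)
    (hQ : Q (s.setArr 2 u (s.arr 2 u + s.arr 0 x * s.arr 1 y))) :
    Halts M (.store 2 w (.op .add (.load 2 w) (.op .mul (.load 0 i) (.load 1 j)))) s C Q := by
  have he : (Expr.op .add (.load 2 w) (.op .mul (.load 0 i) (.load 1 j))).Fits M s := by
    refine ⟨⟨hw.1, ?_⟩, ⟨⟨hi.1, ?_⟩, ⟨hj.1, ?_⟩, ?_⟩, ?_⟩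
    all_goals simpa only [Expr.eval, Op.eval, hw.2, hi.2, hj.2]
  refine (Halts.store hw.1 he ?_).mono (by simp only [Expr.cost]; omega) fun _ h => h
  simpa only [Expr.eval, Op.eval, hw.2, hi.2, hj.2]

lemma halts_naiveMul {M a b c D : ℕ} {F G : ℤ → ℤ} (hF : ∀ z, |F z| ≤ D) (hG : ∀ z, |G z| ≤ D)
    (ha : a ≤ M) (hb : b ≤ M) (hc : c ≤ M) (hab : a * b ≤ M) (hbc : b * c ≤ M) (hac : a * c ≤ M)
    (hM : (a * c * b) * (D * D + 1) + D * D + D ≤ M) :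
    Halts M naiveMul (initial [a, b, c] [F, G]) (a * c * b * 40 + 8) fun s' =>
      ∀ i < a, ∀ k < c, s'.arr 2 ((i * c + k : ℕ) : ℤ) =
        ∑ j ∈ Finset.range b, F (i * b + j : ℕ) * G (j * c + k : ℕ) := by
  set N := a * c * b with hN
  have hNM : N ≤ M := by nlinarith
  have hDM : D ≤ M := by nlinarith
  have hDDM : D * D ≤ M := by nlinarith
  -- `f z` is the product of entries that step `z` of the loop adds to the cell `z / b`
  let f : ℕ → ℤ := fun z => F (z / b / c * b + z % b : ℕ) * G (z % b * c + z / b % c : ℕ)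
  have hf : ∀ z, |f z| ≤ (D * D : ℕ) := fun z => by
    rw [abs_mul]
    push_cast
    exact mul_le_mul (hF _) (hG _) (abs_nonneg _) (by positivity)
  -- `S k w` is the contents of cell `w` after the steps `N - 1, …, k`
  let S : ℕ → ℕ → ℤ := fun k w => ∑ z ∈ Finset.Ico k N, if z / b = w then f z else 0
  have hS : ∀ k w, |S k w| ≤ (N * (D * D) : ℕ) := fun k w => by
    refine (Finset.abs_sum_le_sum_abs _ _).trans ((Finset.sum_le_card_nsmul _ _ ((D * D : ℕ) : ℤ)
      fun z _ => ?_).trans ?_)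
    · split_ifs
      · exact hf z
      · rw [abs_zero]
        positivity
    · rw [nsmul_eq_mul, Nat.card_Ico]
      exact_mod_cast Nat.mul_le_mul_right _ (Nat.sub_le _ _)
  let I : ℕ → State → Prop := fun k s => s.reg 3 = k ∧ s.reg 0 = a ∧ s.reg 1 = b ∧ s.reg 2 = c ∧
    s.arr 0 = F ∧ s.arr 1 = G ∧ ∀ w : ℕ, s.arr 2 w = S k w
  have hT : a * c * b * 40 + 8 = 6 + (N * (34 + 6) + 2) := by omega
  rw [hT]
  refine Halts.seq (T := 6) (Q := I N) ?_ fun s' hs' =>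
    (Halts.countdown (C := 34) I hNM (fun k s h => h.1) ?_ hs').mono le_rfl
      fun s'' h i hi k hk => ?_
  · have h0 : ∀ s : State, s.reg 0 = a → s.reg 1 = b → s.reg 2 = c →
        (Expr.op .mul (.op .mul (.reg 0) (.reg 2)) (.reg 1)).Computes M s N := fun s h0 h1 h2 =>
      .mul (.mul (.reg h0 ha) (.reg h2 hc) hac) (.reg h1 hb) hNM
    have h1 := h0 (initial [a, b, c] [F, G]) rfl rfl rfl
    refine Halts.assign h1.1 ⟨by simp [h1.2], rfl, rfl, rfl, rfl, rfl, fun w => ?_⟩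
    simp [S, initial]
  · rintro k hk s ⟨-, h0, h1, h2, h3, h4, h5⟩
    have hb0 : 0 < b := Nat.pos_of_ne_zero fun h => by simp [hN, h] at hk
    have hw : k / b < a * c := (Nat.div_lt_iff_lt_mul hb0).2 hk
    have hc0 : 0 < c := Nat.pos_of_ne_zero fun h => by simp [h] at hw
    have hi : k / b / c < a := (Nat.div_lt_iff_lt_mul hc0).2 hw
    have hj : k % b < b := Nat.mod_lt _ hb0
    have hk' : k / b % c < c := Nat.mod_lt _ hc0
    set σ := s.setReg 3 k with hσ
    have e3 : (Expr.reg 3).Computes M σ k := .reg (by simp [hσ]) (hk.le.trans hNM)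
    have e1 : (Expr.reg 1).Computes M σ b := .reg (by simp [hσ, h1]) hb
    have e2 : (Expr.reg 2).Computes M σ c := .reg (by simp [hσ, h2]) hc
    have ew := e3.div e1
    have ej := e3.mod e1
    have eA := ((ew.div e2).mul e1 (by nlinarith)).add ej (by nlinarith)
    have eB := (ej.mul e2 (by nlinarith)).add (ew.mod e2) (by nlinarith)
    have lA := hF (k / b / c * b + k % b : ℕ)
    have lB := hG (k % b * c + k / b % c : ℕ)
    have hsucc : S k (k / b) = S (k + 1) (k / b) + f k := by
      simp only [S]
      rw [Finset.sum_eq_sum_Ico_succ_bot hk, if_pos rfl, add_comm]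
    have hSk : |S k (k / b)| ≤ M := (hS _ _).trans (by exact_mod_cast (by nlinarith))
    have hSk' : |S (k + 1) (k / b)| ≤ M := (hS _ _).trans (by exact_mod_cast (by nlinarith))
    have hfk : |f k| ≤ M := (hf k).trans (by exact_mod_cast hDDM)
    have g2 : σ.arr 2 (k / b : ℕ) = S (k + 1) (k / b) := h5 _
    have g0 : σ.arr 0 (k / b / c * b + k % b : ℕ) = F (k / b / c * b + k % b : ℕ) :=
      congrFun h3 _
    have g1 : σ.arr 1 (k % b * c + k / b % c : ℕ) = G (k % b * c + k / b % c : ℕ) :=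
      congrFun h4 _
    refine halts_addMul ew eA eB ?_ ?_ ?_ ?_ ?_ (by simp [Expr.cost]) ?_
    · rwa [g2]
    · rw [g0]
      exact lA.trans (by exact_mod_cast hDM)
    · rw [g1]
      exact lB.trans (by exact_mod_cast hDM)
    · rw [g0, g1]
      exact hfk
    · rw [g0, g1, g2]
      exact hsucc ▸ hSk
    · refine ⟨by simp [hσ], by simp [hσ, h0], by simp [hσ, h1], by simp [hσ, h2], h3, h4,
        fun w => ?_⟩
      rw [State.arr_setArr, if_pos rfl, g0, g1, g2]
      by_cases hwk : w = k / b
      · subst hwk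
        rw [Function.update_self, hsucc]
      · rw [Function.update_of_ne (by exact_mod_cast hwk), hσ, State.arr_setReg, h5]
        simp only [S]
        rw [Finset.sum_eq_sum_Ico_succ_bot hk, if_neg (Ne.symm hwk), zero_add]
  · rw [h.2.2.2.2.2.2]
    simp only [S]
    rw [← Finset.range_eq_Ico, hN, sum_range_mul_eq, Finset.sum_eq_single (i * c + k)]
    · refine Finset.sum_congr rfl fun j hj => ?_
      have hj := Finset.mem_range.1 hj
      have h1 : ((i * c + k) * b + j) / b = i * c + k := by
        rw [mul_comm _ b, Nat.mul_add_div (by omega), Nat.div_eq_of_lt hj, add_zero]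
      have h2 : ((i * c + k) * b + j) % b = j := by
        rw [Nat.mul_add_mod_self_right, Nat.mod_eq_of_lt hj]
      have h3 : (i * c + k) / c = i := by
        rw [mul_comm _ c, Nat.mul_add_div (by omega), Nat.div_eq_of_lt hk, add_zero]
      have h4 : (i * c + k) % c = k := by
        rw [Nat.mul_add_mod_self_right, Nat.mod_eq_of_lt hk]
      rw [if_pos h1]
      simp only [f]
      rw [h1, h2, h3, h4]
    · intro w _ hw
      refine Finset.sum_eq_zero fun j hj => if_neg ?_
      have hj := Finset.mem_range.1 hj
      rwa [mul_comm _ b, Nat.mul_add_div (by omega), Nat.div_eq_of_lt hj, add_zero]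
    · intro h
      refine absurd (Finset.mem_range.2 ?_) h
      have h1 : (i + 1) * c ≤ a * c := Nat.mul_le_mul_right _ hi
      rw [add_mul, one_mul] at h1
      omega

end WordRAM

lemma isBigO_add_one_pow (k : ℕ) :
    (fun n : ℕ => ((n : ℝ) + 1) ^ k) =O[Filter.atTop] fun n : ℕ => (n : ℝ) ^ k := by
  refine Asymptotics.IsBigO.of_bound (2 ^ k) (Filter.eventually_atTop.2 ⟨1, fun n hn => ?_⟩)
  have hn : (1 : ℝ) ≤ n := by exact_mod_cast hn
  rw [Real.norm_of_nonneg (by positivity), Real.norm_of_nonneg (by positivity), ← mul_pow]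
  exact pow_le_pow_left₀ (by positivity) (by linarith) _

theorem matMulInTime_naive (p q s : ℕ) : MatMulInTime p q s (p + q + s : ℕ) := by
  refine ⟨naiveMul, fun d => ⟨fun n => 48 * (n + 1) ^ (p + q + s),
    fun n => 4 * (n + 1) ^ (p + q + s + 2 * d), p + q + s + 2 * d, ?_, ?_, fun x => ?_⟩⟩
  · simp only [Real.rpow_natCast]
    push_cast
    exact (isBigO_add_one_pow _).const_mul_left _
  · push_cast
    exact (isBigO_add_one_pow _).const_mul_left _
  · obtain ⟨n, A, B, hA, hB⟩ := x
    have hle : ∀ {u v : ℕ}, u ≤ v → n ^ u ≤ (n + 1) ^ v := fun {u v} h =>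
      (Nat.pow_le_pow_left (Nat.le_succ n) u).trans (Nat.pow_le_pow_right (Nat.succ_pos n) h)
    have hD : (0 : ℤ) ≤ (n ^ d : ℕ) := by positivity
    have hF : ∀ z, |rowMajor A z| ≤ (n ^ d : ℕ) :=
      abs_rowMajor_le hD fun i j => by exact_mod_cast hA i j
    have hG : ∀ z, |rowMajor B z| ≤ (n ^ d : ℕ) :=
      abs_rowMajor_le hD fun i j => by exact_mod_cast hB i j
    have hpq := hle (u := p + q) (v := p + q + s + 2 * d) (by omega)
    have hqs := hle (u := q + s) (v := p + q + s + 2 * d) (by omega)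
    have hps := hle (u := p + s) (v := p + q + s + 2 * d) (by omega)
    have h1 := hle (u := p + s + q) (v := p + q + s) (by omega)
    have h2 := hle (u := p + s + q + (d + d)) (v := p + q + s + 2 * d) (by omega)
    have h3 := hle (u := p + s + q) (v := p + q + s + 2 * d) (by omega)
    have h4 := hle (u := d + d) (v := p + q + s + 2 * d) (by omega)
    simp only [pow_add] at hpq hqs hps h1 h2 h3 h4
    have h := halts_naiveMul (M := 4 * (n + 1) ^ (p + q + s + 2 * d)) (a := powDim n p)
      (b := powDim n q) (c := powDim n s) hF hG
    simp only [powDim_natCast] at h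
    obtain ⟨r, s', hr, hr', hs'⟩ := h
      ((hle (by omega)).trans (Nat.le_mul_of_pos_left _ (by norm_num)))
      ((hle (by omega)).trans (Nat.le_mul_of_pos_left _ (by norm_num)))
      ((hle (by omega)).trans (Nat.le_mul_of_pos_left _ (by norm_num)))
      (by simp only [pow_add]; omega) (by simp only [pow_add]; omega)
      (by simp only [pow_add]; omega)
      (by
        have h5 := hle (u := d) (v := p + q + s + 2 * d) (by omega)
        simp only [pow_add] at h5
        simp only [pow_add]
        rw [mul_add, mul_one]
        omega)
    refine ⟨r, s', ?_, hr'.trans ?_, fun i k => ?_⟩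
    · simpa only [matMulProblem, powDim_natCast] using hr
    · simp only [pow_add]
      have : 1 ≤ (n + 1) ^ p * (n + 1) ^ q * (n + 1) ^ s := Nat.one_le_iff_ne_zero.2 (by positivity)
      simp only [matMulProblem]
      omega
    · have h5 := hs' i (by simpa only [powDim_natCast] using i.2) k
        (by simpa only [powDim_natCast] using k.2)
      push_cast at h5
      simp only [powDim_natCast]
      push_cast
      rw [h5, Matrix.mul_apply, Finset.sum_range]
      refine Finset.sum_bij' (fun j _ => ⟨j, by rw [powDim_natCast]; exact j.2⟩)
        (fun j _ => ⟨j, by simpa only [powDim_natCast] using j.2⟩) (by simp) (by simp) (by simp)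
        (by simp) fun j _ => ?_
      have hA' := rowMajor_apply A i ⟨j, by rw [powDim_natCast]; exact j.2⟩
      have hB' := rowMajor_apply B ⟨j, by rw [powDim_natCast]; exact j.2⟩ k
      simp only [powDim_natCast] at hA' hB'
      push_cast at hA' hB'
      rw [hA', hB']

/-! ### Clique matrices and tests for complete subgraphs -/

open Classical in
/-- The indicator of the codes of complete subgraphs. -/
noncomputable def SimpleGraph.cliqueInd {n : ℕ} (G : SimpleGraph (Fin n)) (m z : ℕ) : ℕ :=
  if G.IsCliqueCode m z then 1 else 0

lemma SimpleGraph.cliqueInd_le_one {n : ℕ} (G : SimpleGraph (Fin n)) (m z : ℕ) :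
    G.cliqueInd m z ≤ 1 := by
  unfold SimpleGraph.cliqueInd
  split_ifs <;> simp

lemma SimpleGraph.cliqueInd_ne_zero {n : ℕ} {G : SimpleGraph (Fin n)} {m z : ℕ} :
    G.cliqueInd m z ≠ 0 ↔ G.IsCliqueCode m z := by
  simp [SimpleGraph.cliqueInd]

lemma SimpleGraph.cliqueInd_glue {n : ℕ} (G : SimpleGraph (Fin n)) {p q s i j k : ℕ}
    (hj : j < n ^ q) (hk : k < n ^ s) :
    G.cliqueInd (s + (q + p)) ((i * n ^ q + j) * n ^ s + k) =
      G.cliqueInd (s + p) (i * n ^ s + k) *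
        (G.cliqueInd (q + p) (i * n ^ q + j) * G.cliqueInd (s + q) (j * n ^ s + k)) := by
  classical
  have h := G.isCliqueCode_glue (p := p) (i := i) hj hk
  rw [show k + n ^ s * (j + n ^ q * i) = (i * n ^ q + j) * n ^ s + k by ring] at h
  unfold SimpleGraph.cliqueInd
  rw [if_congr h rfl rfl]
  split_ifs <;> simp_all

namespace HostGraph

variable (x : HostGraph)

/-- The entry number `z`, in the order of rows, of the product of the `n ^ p × n ^ q` matrix and the
`n ^ q × n ^ s` matrix that say which pairs of tuples form a complete subgraph together. -/
noncomputable def productEntry (p q s z : ℕ) : ℕ :=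
  ∑ j ∈ Finset.range (x.n ^ q), x.G.cliqueInd (q + p) (z / x.n ^ s * x.n ^ q + j) *
    x.G.cliqueInd (s + q) (j * x.n ^ s + z % x.n ^ s)

lemma productEntry_le (p q s z : ℕ) : x.productEntry p q s z ≤ x.n ^ q := by
  refine (Finset.sum_le_card_nsmul _ _ 1 fun j _ => ?_).trans (by simp)
  exact Nat.mul_le_mul (x.G.cliqueInd_le_one _ _) (x.G.cliqueInd_le_one _ _)

/-- Each complete subgraph on `p + q + s` vertices is counted once, in the entry that belongs to its
`p` last and its `s` first vertices. -/
lemma sum_cliqueInd_mul_productEntry (p q s : ℕ) :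
    ∑ z ∈ Finset.range (x.n ^ p * x.n ^ s), x.G.cliqueInd (s + p) z * x.productEntry p q s z =
      x.G.copyCount (SimpleGraph.completeGraph (Fin (s + (q + p)))) := by
  classical
  rw [← SimpleGraph.card_isCliqueCode, Finset.card_filter,
    show x.n ^ (s + (q + p)) = x.n ^ p * x.n ^ q * x.n ^ s by ring, sum_range_mul_eq,
    sum_range_mul_eq, sum_range_mul_eq]
  refine Finset.sum_congr rfl fun i _ => ?_
  rw [Finset.sum_comm]
  refine Finset.sum_congr rfl fun k hk => ?_
  have hk := Finset.mem_range.1 hk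
  rw [productEntry, Finset.mul_sum]
  refine Finset.sum_congr rfl fun j hj => ?_
  have h1 : (i * x.n ^ s + k) / x.n ^ s = i := by
    rw [mul_comm, Nat.mul_add_div (by omega), Nat.div_eq_of_lt hk, add_zero]
  have h2 : (i * x.n ^ s + k) % x.n ^ s = k := by
    rw [Nat.mul_add_mod_self_right, Nat.mod_eq_of_lt hk]
  rw [h1, h2, ← x.G.cliqueInd_glue (Finset.mem_range.1 hj) hk]
  rfl

lemma input_arr_zero {a b : ℕ} (ha : a < x.n) (hb : b < x.n) [Decidable (x.G.Adj ⟨a, ha⟩ ⟨b, hb⟩)] :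
    x.input.arr 0 ((a * x.n + b : ℕ) : ℤ) = if x.G.Adj ⟨a, ha⟩ ⟨b, hb⟩ then 1 else 0 := by
  classical
  have h := rowMajor_apply (x.G.adjMatrix ℤ) ⟨a, ha⟩ ⟨b, hb⟩
  rw [SimpleGraph.adjMatrix_apply] at h
  push_cast
  refine Eq.trans ?_ (h.trans ?_)
  · simp only [HostGraph.input, initial, List.getD_cons_zero]
  · congr

/-- The memory holds the adjacency matrix of the graph in array `0`, and the number of vertices in
register `w`. -/
structure HeldBy (w : ℕ) (s : State) : Prop where
  reg : s.reg w = x.n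
  arr : s.arr 0 = x.input.arr 0

end HostGraph

namespace WordRAM

/-- The power `n ^ k` of the contents `n` of register `w`. -/
def powExpr (w : ℕ) : ℕ → Expr
  | 0 => .const 1
  | k + 1 => .op .mul (powExpr w k) (.reg w)

/-- The `m` lowest digits of `e` in base `n`, for `n` in register `w`; see `digitList`. -/
def digitExprs (w : ℕ) : ℕ → Expr → List Expr
  | 0, _ => []
  | m + 1, e => .op .mod e (.reg w) :: digitExprs w m (.op .div e (.reg w))

/-- The test whether `e` and `f` are joined by an edge that leads upwards. -/
def ascendsExpr (w : ℕ) (e f : Expr) : Expr :=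
  .op .mul (.op .le e f) (.load 0 (.op .add (.op .mul e (.reg w)) f))

/-- The test whether upward edges lead from `e` to all members of a list. -/
def ascendsAllExpr (w : ℕ) (e : Expr) : List Expr → Expr
  | [] => .const 1
  | f :: l => .op .mul (ascendsExpr w e f) (ascendsAllExpr w e l)

/-- The test whether any two members of a list are joined by an upward edge. -/
def pairwiseExpr (w : ℕ) : List Expr → Expr
  | [] => .const 1
  | e :: l => .op .mul (ascendsAllExpr w e l) (pairwiseExpr w l)

/-- The test whether the value of `e` is the code of a complete subgraph on `m` vertices. -/
def cliqueExpr (w m : ℕ) (e : Expr) : Expr := pairwiseExpr w (digitExprs w m e)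

variable {M w : ℕ} {s : State}

lemma computes_powExpr {n : ℕ} (hs : s.reg w = n) {k : ℕ} (hM : (n + 1) ^ k ≤ M) :
    (powExpr w k).Computes M s (n ^ k) := by
  induction k with
  | zero => exact .const (by simpa using hM)
  | succ k ih =>
    have h1 : (n + 1) ^ k ≤ M := (Nat.pow_le_pow_right (Nat.succ_pos n) (Nat.le_succ k)).trans hM
    have h2 : n ^ (k + 1) ≤ M := (Nat.pow_le_pow_left (Nat.le_succ n) _).trans hM
    have h3 : n ≤ M := by
      refine le_trans ?_ hM
      rw [pow_succ]
      nlinarith [Nat.one_le_pow k (n + 1) (Nat.succ_pos n)]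
    exact (ih h1).mul (.reg hs h3) h2

lemma computes_digitExprs {n v : ℕ} {e : Expr} (hs : s.reg w = n) (hn : n ≤ M)
    (he : e.Computes M s v) (m : ℕ) :
    List.Forall₂ (Expr.Computes M s) (digitExprs w m e) (digitList n m v) := by
  induction m generalizing e v with
  | zero => exact .nil
  | succ m ih => exact .cons (he.mod (.reg hs hn)) (ih (he.div (.reg hs hn)))

section

variable {x : HostGraph} (hx : x.HeldBy w s) (hM : x.n * x.n ≤ M)
include hx hM

open Classical in
lemma computes_ascendsExpr {a b : ℕ} {e f : Expr} (ha : a < x.n) (hb : b < x.n)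
    (he : e.Computes M s a) (hf : f.Computes M s b) :
    (ascendsExpr w e f).Computes M s (if x.G.Ascends a b then 1 else 0) := by
  have h1 : 1 ≤ M := by nlinarith
  have h2 : (Expr.op .le e f).Computes M s (if a ≤ b then 1 else 0) :=
    .op he hf (by simp [Op.eval]) (by split_ifs <;> omega)
  have hi := (he.mul (.reg hx.reg (by nlinarith)) (by nlinarith)).add hf (by nlinarith)
  have h3 : (Expr.load 0 (.op .add (.op .mul e (.reg w)) f)).Computes M s
      (if x.G.Adj ⟨a, ha⟩ ⟨b, hb⟩ then 1 else 0) :=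
    hi.load (by rw [hx.arr, x.input_arr_zero ha hb]; push_cast; rfl) (by split_ifs <;> omega)
  have h4 := h2.mul h3 (by split_ifs <;> omega)
  refine h4.congr ?_
  simp only [SimpleGraph.Ascends, ha, hb, exists_true_left]
  split_ifs <;> simp_all

open Classical in
lemma computes_ascendsAllExpr {a : ℕ} {e : Expr} (ha : a < x.n) (he : e.Computes M s a)
    {l : List Expr} {v : List ℕ} (hv : ∀ b ∈ v, b < x.n)
    (hl : List.Forall₂ (Expr.Computes M s) l v) :
    (ascendsAllExpr w e l).Computes M s (if ∀ b ∈ v, x.G.Ascends a b then 1 else 0) := by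
  have h1 : 1 ≤ M := by nlinarith
  induction hl with
  | nil => exact .const (by simpa using h1)
  | cons hf _ ih =>
    have h2 := (computes_ascendsExpr hx hM ha (hv _ (by simp)) he hf).mul
      (ih fun b hb => hv b (List.mem_cons_of_mem _ hb)) (by split_ifs <;> omega)
    refine h2.congr ?_
    simp only [List.forall_mem_cons]
    split_ifs <;> simp_all

open Classical in
lemma computes_pairwiseExpr (h1 : 1 ≤ M) {l : List Expr} {v : List ℕ} (hv : ∀ b ∈ v, b < x.n)
    (hl : List.Forall₂ (Expr.Computes M s) l v) :
    (pairwiseExpr w l).Computes M s (if v.Pairwise x.G.Ascends then 1 else 0) := by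
  induction hl with
  | nil => exact .const (by simpa using h1)
  | cons hf hl ih =>
    have h2 := (computes_ascendsAllExpr hx hM (hv _ (by simp)) hf
      (fun b hb => hv b (List.mem_cons_of_mem _ hb)) hl).mul
      (ih fun b hb => hv b (List.mem_cons_of_mem _ hb)) (by split_ifs <;> omega)
    refine h2.congr ?_
    simp only [List.pairwise_cons]
    split_ifs <;> simp_all

lemma computes_cliqueExpr (hn : 0 < x.n) {v : ℕ} {e : Expr} (he : e.Computes M s v) (m : ℕ) :
    (cliqueExpr w m e).Computes M s (x.G.cliqueInd m v) :=
  (computes_pairwiseExpr hx hM (by nlinarith) (fun _ hb => lt_of_mem_digitList hn hb)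
    (computes_digitExprs hx.reg (by nlinarith) he m)).congr
    (by simp only [SimpleGraph.cliqueInd, SimpleGraph.IsCliqueCode]; congr)

end

/-! ### The programs -/

/-- The program that writes the two clique matrices and multiplies them; see
`HostGraph.productEntry`. Its own registers are `w` for the number of
vertices and `w + 1`, `w + 2`, `w + 3`; the multiplication program `P` uses the registers from
`w + 4` and the arrays from `1` on, so that its result is in array `3`. -/
def multiplyProg (P : Prog) (p q s w : ℕ) : Prog :=
  .seq (.assign w (.reg 0)) <| .seq (.assign (w + 4) (powExpr w p)) <|
  .seq (.assign (w + 5) (powExpr w q)) <| .seq (.assign (w + 6) (powExpr w s)) <|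
  .seq (.fill (w + 1) 1 (.op .mul (powExpr w p) (powExpr w q))
    (cliqueExpr w (q + p) (.reg (w + 1)))) <|
  .seq (.fill (w + 1) 2 (.op .mul (powExpr w q) (powExpr w s))
    (cliqueExpr w (s + q) (.reg (w + 1)))) <|
  P.shift (w + 4) 1

/-- The product of the indicator of the codes and the matrix product, for the cell whose number is
in register `w + 1`. -/
def weightExpr (p s w : ℕ) : Expr :=
  .op .mul (cliqueExpr w (s + p) (.reg (w + 1))) (.load 3 (.reg (w + 1)))

/-- The program that counts complete subgraphs on `p + q + s` vertices, as the weighted sum of the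
entries of the product. -/
def countProg (P : Prog) (p q s w : ℕ) : Prog :=
  .seq (multiplyProg P p q s w) <|
  .seq (.sumUp (w + 1) (w + 2) (.op .mul (powExpr w p) (powExpr w s)) (weightExpr p s w)) <|
  .assign 0 (.reg (w + 2))

/-- The program that writes the values of a list of expressions into the registers `i`, `i + 1`, and
so on. -/
def assignList : ℕ → List Expr → Prog
  | _, [] => .skip
  | i, e :: l => .seq (.assign i e) (assignList (i + 1) l)

/-- The test whether the tuple in register `w + 1` completes the two tuples whose cell has its
number in register `w + 2`. -/
def middleExpr (p q s w : ℕ) : Expr :=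
  .op .mul
    (cliqueExpr w (q + p) (.op .add
      (.op .mul (.op .div (.reg (w + 2)) (powExpr w s)) (powExpr w q)) (.reg (w + 1))))
    (cliqueExpr w (s + q) (.op .add
      (.op .mul (.reg (w + 1)) (powExpr w s)) (.op .mod (.reg (w + 2)) (powExpr w s))))

/-- The code of the complete subgraph whose outer vertices are given by the cell number in register
`w + 2`, and the middle ones by register `w + 3`. -/
def codeExpr (q s w : ℕ) : Expr :=
  .op .add
    (.op .mul (.op .add (.op .mul (.op .div (.reg (w + 2)) (powExpr w s)) (powExpr w q))
      (.reg (w + 3))) (powExpr w s))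
    (.op .mod (.reg (w + 2)) (powExpr w s))

/-- The program that finds a complete subgraph on `p + q + s` vertices. It looks for a cell of the
product with nonzero weight, which gives all but the `q` middle vertices, and then for those. Its
answer goes to the registers from `0` on, which have to lie below `w`. -/
def findProg (P : Prog) (p q s w : ℕ) : Prog :=
  .seq (multiplyProg P p q s w) <|
  .seq (.search (w + 1) (w + 2) (.op .mul (powExpr w p) (powExpr w s)) (weightExpr p s w)) <|
  .seq (.search (w + 1) (w + 3) (powExpr w q) (middleExpr p q s w)) <|
  .seq (.assign (w + 2) (codeExpr q s w)) <|
  assignList 0 (digitExprs w (s + (q + p)) (.reg (w + 2)))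

lemma le_of_linear {a b N E : ℕ} (hN : N ≤ E) (hE : 1 ≤ E) : a + (N * b + 2) ≤ (a + b + 2) * E := by
  nlinarith [Nat.mul_le_mul_right b hN]

/-- All parts but the multiplication take time `O(n ^ (p + s))`, since `q ≤ p` and `q ≤ s`. -/
lemma halts_multiplyProg (P : Prog) {p q s : ℕ} (w : ℕ) (hq : 0 < q) (hqp : q ≤ p) (hqs : q ≤ s) :
    ∃ C : ℕ, ∀ (x : HostGraph) (M T : ℕ), (x.n + 1) ^ (p + q + s) ≤ M →
      MultipliesBits P M T (x.n ^ p) (x.n ^ q) (x.n ^ s) →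
      Halts M (multiplyProg P p q s w) x.input (T + C * (x.n + 1) ^ (p + s)) fun s' =>
        x.HeldBy w s' ∧ s'.reg (w + 2) = 0 ∧
          ∀ z < x.n ^ p * x.n ^ s, s'.arr 3 (z : ℤ) = x.productEntry p q s z := by
  refine ⟨2 + ((powExpr w p).cost + 1) + ((powExpr w q).cost + 1) + ((powExpr w s).cost + 1) +
    ((Expr.op .mul (powExpr w p) (powExpr w q)).cost + 1 +
      (1 + (cliqueExpr w (q + p) (.reg (w + 1))).cost + 1 + 6) + 2) +
    ((Expr.op .mul (powExpr w q) (powExpr w s)).cost + 1 +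
      (1 + (cliqueExpr w (s + q) (.reg (w + 1))).cost + 1 + 6) + 2), fun x M T hM hP => ?_⟩
  set n := x.n with hn
  set E := (n + 1) ^ (p + s)
  have hle : ∀ {u}, u ≤ p + q + s → (n + 1) ^ u ≤ M := fun h =>
    (Nat.pow_le_pow_right (Nat.succ_pos n) h).trans hM
  have hlt : ∀ {u}, u ≤ p + q + s → n ^ u ≤ M := fun h =>
    (Nat.pow_le_pow_left (Nat.le_succ n) _).trans (hle h)
  have hEle : ∀ {u}, u ≤ p + s → n ^ u ≤ E := fun h =>
    (Nat.pow_le_pow_left (Nat.le_succ n) _).trans (Nat.pow_le_pow_right (Nat.succ_pos n) h)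
  have hE : 1 ≤ E := Nat.one_le_pow _ _ (Nat.succ_pos n)
  have hnn : n * n ≤ M := by
    have h := hlt (u := 2) (by omega)
    rwa [pow_two] at h
  have hnM : n ≤ M := by simpa using hlt (u := 1) (by omega)
  have hpq : n ^ p * n ^ q ≤ M := by rw [← pow_add]; exact hlt (by omega)
  have hqs' : n ^ q * n ^ s ≤ M := by rw [← pow_add]; exact hlt (by omega)
  have hpqE : n ^ p * n ^ q ≤ E := by rw [← pow_add]; exact hEle (by omega)
  have hqsE : n ^ q * n ^ s ≤ E := by rw [← pow_add]; exact hEle (by omega)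
  have h0 : (Expr.reg 0).Computes M x.input n := .reg rfl hnM
  -- the memory after the first four assignments
  set s1 := ((((x.input.setReg w n).setReg (w + 4) (n ^ p : ℕ)).setReg (w + 5) (n ^ q : ℕ)).setReg
    (w + 6) (n ^ s : ℕ)) with hs1
  have main : Halts M (.seq (.fill (w + 1) 1 (.op .mul (powExpr w p) (powExpr w q))
      (cliqueExpr w (q + p) (.reg (w + 1)))) <|
    .seq (.fill (w + 1) 2 (.op .mul (powExpr w q) (powExpr w s))
      (cliqueExpr w (s + q) (.reg (w + 1)))) <| P.shift (w + 4) 1) s1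
      (((Expr.op .mul (powExpr w p) (powExpr w q)).cost + 1 +
        (1 + (cliqueExpr w (q + p) (.reg (w + 1))).cost + 1 + 6) + 2) * E +
      (((Expr.op .mul (powExpr w q) (powExpr w s)).cost + 1 +
        (1 + (cliqueExpr w (s + q) (.reg (w + 1))).cost + 1 + 6) + 2) * E + T)) fun s' =>
        x.HeldBy w s' ∧ s'.reg (w + 2) = 0 ∧
          ∀ z < n ^ p * n ^ s, s'.arr 3 (z : ℤ) = x.productEntry p q s z := by
    have hw1 : s1.reg w = n := by simp [hs1]
    refine Halts.seq ((Halts.fill (f := x.G.cliqueInd (q + p)) (.mul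
      (computes_powExpr hw1 (hle (by omega))) (computes_powExpr hw1 (hle (by omega))) hpq)
      (by simp [hs1, HostGraph.input, initial]) fun k hk s' hr ha hi => ?_).mono
      (le_of_linear hpqE hE) fun _ h => h) ?_
    · refine computes_cliqueExpr ⟨(hr w (by omega)).trans hw1, ha 0 (by omega)⟩ hnn ?_
        (.reg hi (hk.le.trans hpq)) _
      refine Nat.pos_of_ne_zero fun h => ?_
      rw [hn, h, zero_pow (by omega), zero_mul] at hk
      omega
    rintro s2 ⟨hr2, ha2, hc2⟩
    have hw2 : s2.reg w = n := (hr2 w (by omega)).trans hw1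
    refine Halts.seq ((Halts.fill (f := x.G.cliqueInd (s + q)) (.mul
      (computes_powExpr hw2 (hle (by omega))) (computes_powExpr hw2 (hle (by omega))) hqs')
      ((ha2 2 (by omega)).trans (by simp [hs1, HostGraph.input, initial]))
      fun k hk s' hr ha hi => ?_).mono (le_of_linear hqsE hE) fun _ h => h) ?_
    · refine computes_cliqueExpr ⟨(hr w (by omega)).trans hw2,
        (ha 0 (by omega)).trans (ha2 0 (by omega))⟩ hnn ?_ (.reg hi (hk.le.trans hqs')) _
      refine Nat.pos_of_ne_zero fun h => ?_
      rw [hn, h, zero_pow (by omega), zero_mul] at hk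
      omega
    rintro s3 ⟨hr3, ha3, hc3⟩
    have hr : ∀ y, y ≠ w + 1 → s3.reg y = s1.reg y := fun y hy => (hr3 y hy).trans (hr2 y hy)
    have hshift : (initial [((n ^ p : ℕ) : ℤ), ((n ^ q : ℕ) : ℤ), ((n ^ s : ℕ) : ℤ)]
        [cells (n ^ p * n ^ q) fun z => x.G.cliqueInd (q + p) z,
          cells (n ^ q * n ^ s) fun z => x.G.cliqueInd (s + q) z]).ShiftsTo (w + 4) 1 s3 := by
      refine ⟨fun y => ?_, fun a => ?_⟩
      · rw [hr _ (by omega)]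
        match y with
        | 0 => simp [hs1, initial]
        | 1 => simp [hs1, initial, show 1 + (w + 4) = w + 5 by omega]
        | 2 => simp [hs1, initial, show 2 + (w + 4) = w + 6 by omega]
        | y + 3 =>
          simp [hs1, initial, HostGraph.input, show y + 3 + (w + 4) = (w + y + 6) + 1 by omega]
          omega
      · match a with
        | 0 => exact (ha3 1 (by omega)).trans hc2
        | 1 => exact hc3
        | a + 2 =>
          rw [ha3 _ (by omega), ha2 _ (by omega)]
          simp [hs1, initial, HostGraph.input]
    refine ((hP _ _ (x.G.cliqueInd_le_one _) (x.G.cliqueInd_le_one _)).shift hshift).mono le_rfl ?_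
    rintro s4 ⟨⟨s', hs', hQ⟩, hr4, ha4⟩
    refine ⟨⟨?_, ?_⟩, ?_, fun z hz => ?_⟩
    · rw [hr4 _ (by omega), hr _ (by omega), hw1]
    · rw [ha4 _ (by omega), ha3 _ (by omega), ha2 _ (by omega)]
      rfl
    · rw [hr4 _ (by omega), hr _ (by omega)]
      simp [hs1, HostGraph.input, initial]
    · have hs0 : 0 < n ^ s := Nat.pos_of_ne_zero fun h => by simp [h] at hz
      have h := hQ (z / n ^ s) ((Nat.div_lt_iff_lt_mul hs0).2 hz) (z % n ^ s) (Nat.mod_lt _ hs0)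
      rw [Nat.div_add_mod'] at h
      rw [hs'.2 2, h]
      rfl
  have hA : ∀ {k y : ℕ} {e : Expr} {s : State} {P' : Prog} {T' : ℕ} {Q : State → Prop},
      e.Computes M s k → Halts M P' (s.setReg y k) T' Q →
      Halts M (.seq (.assign y e) P') s (e.cost + 1 + T') Q := fun he h =>
    Halts.seq (Q := fun s' => s' = _) (Halts.assign he.1 (by rw [he.2])) fun s' hs' => hs' ▸ h
  refine (hA h0 <| hA (computes_powExpr (n := n) (by simp) (hle (by omega))) <|
    hA (computes_powExpr (n := n) (by simp) (hle (by omega))) <|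
    hA (computes_powExpr (n := n) (by simp) (hle (by omega))) main).mono ?_ fun _ h => h
  simp only [Expr.cost]
  nlinarith

/-- The weights of the cells, as the final loops compute them. -/
lemma computes_weightExpr {x : HostGraph} {p q s w M k : ℕ} {σ : State} (hx : x.HeldBy w σ)
    (hp : 0 < p) (hnn : x.n * x.n ≤ M) (hM : x.n ^ p * x.n ^ s ≤ M) (hq : x.n ^ q ≤ M)
    (hk : k < x.n ^ p * x.n ^ s) (hi : σ.reg (w + 1) = k)
    (ha : σ.arr 3 (k : ℤ) = x.productEntry p q s k) :
    (weightExpr p s w).Computes M σ (x.G.cliqueInd (s + p) k * x.productEntry p q s k) := by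
  have hn : 0 < x.n := Nat.pos_of_ne_zero fun h => by
    rw [h, zero_pow (by omega), zero_mul] at hk
    omega
  have h1 := (x.productEntry_le p q s k).trans hq
  have h2 : (Expr.reg (w + 1)).Computes M σ k := .reg hi (hk.le.trans hM)
  refine (computes_cliqueExpr hx hnn hn h2 _).mul (h2.load ha h1) ?_
  have h3 := x.G.cliqueInd_le_one (s + p) k
  nlinarith

lemma halts_countProg (P : Prog) {p q s : ℕ} (hq : 0 < q) (hqp : q ≤ p) (hqs : q ≤ s) :
    ∃ C : ℕ, ∀ (x : HostGraph) (M T : ℕ), (x.n + 1) ^ (p + q + s) ≤ M →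
      MultipliesBits P M T (x.n ^ p) (x.n ^ q) (x.n ^ s) →
      Halts M (countProg P p q s 0) x.input (T + C * (x.n + 1) ^ (p + s))
        ((countCliquesProblem (s + (q + p))).Correct x) := by
  obtain ⟨C, hC⟩ := halts_multiplyProg P (w := 0) hq hqp hqs
  refine ⟨C + ((Expr.op .mul (powExpr 0 p) (powExpr 0 s)).cost + 1 +
    (1 + (weightExpr p s 0).cost + 1 + 1 + 6) + 2) + 2, fun x M T hM hP => ?_⟩
  set n := x.n with hn
  have hle : ∀ {u}, u ≤ p + q + s → (n + 1) ^ u ≤ M := fun h =>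
    (Nat.pow_le_pow_right (Nat.succ_pos n) h).trans hM
  have hlt : ∀ {u}, u ≤ p + q + s → n ^ u ≤ M := fun h =>
    (Nat.pow_le_pow_left (Nat.le_succ n) _).trans (hle h)
  have hnn : n * n ≤ M := by
    have h := hlt (u := 2) (by omega)
    rwa [pow_two] at h
  have hps : n ^ p * n ^ s ≤ M := by rw [← pow_add]; exact hlt (by omega)
  have hpsE : n ^ p * n ^ s ≤ (n + 1) ^ (p + s) := by
    rw [← pow_add]; exact Nat.pow_le_pow_left (Nat.le_succ n) _
  have hsum : ∑ z ∈ Finset.range (n ^ p * n ^ s),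
      x.G.cliqueInd (s + p) z * x.productEntry p q s z ≤ M := by
    refine (Finset.sum_le_card_nsmul _ _ (n ^ q) fun z _ => ?_).trans ?_
    · have h1 := x.G.cliqueInd_le_one (s + p) z
      have h2 := x.productEntry_le p q s z
      nlinarith
    · rw [Finset.card_range, nsmul_eq_mul, Nat.cast_id]
      refine le_of_eq_of_le ?_ (hlt (u := p + q + s) le_rfl)
      ring
  refine ((hC x M T hM hP).seq fun s1 h1 => ?_).mono (T := T + C * (n + 1) ^ (p + s) +
    (((Expr.op .mul (powExpr 0 p) (powExpr 0 s)).cost + 1 +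
    (1 + (weightExpr p s 0).cost + 1 + 1 + 6) + 2) * (n + 1) ^ (p + s) + 2)) ?_ fun _ h => h
  · obtain ⟨hx1, hz1, hc1⟩ := h1
    refine Halts.seq ((Halts.sumUp
      (f := fun z => x.G.cliqueInd (s + p) z * x.productEntry p q s z) (by omega)
      (.mul (computes_powExpr hx1.reg (hle (by omega))) (computes_powExpr hx1.reg (hle (by omega)))
        hps) hz1 hsum fun k hk s' hr ha hi => ?_).mono
      (le_of_linear hpsE (Nat.one_le_pow _ _ (Nat.succ_pos n)))
      fun _ h => h) ?_
    · exact computes_weightExpr ⟨(hr 0 (by omega) (by omega)).trans hx1.reg,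
        (congrFun ha 0).trans hx1.arr⟩ (by omega) hnn hps (hlt (by omega)) hk hi
        ((congrFun (congrFun ha 3) _).trans (hc1 k hk))
    · intro s2 h2
      have h3 : (Expr.reg (0 + 2)).Computes M s2 _ := .reg h2 hsum
      refine Halts.assign (e := .reg (0 + 2)) h3.1 ?_
      simp only [countCliquesProblem, State.reg_setReg, if_pos]
      rw [h3.2, x.sum_cliqueInd_mul_productEntry]
  · have : 1 ≤ (n + 1) ^ (p + s) := Nat.one_le_pow _ _ (Nat.succ_pos n)
    nlinarith

lemma halts_assignList {M w : ℕ} {l : List Expr} {v : List ℕ} {i : ℕ} {s : State}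
    (hl : ∀ s' : State, (∀ y, w ≤ y → s'.reg y = s.reg y) →
      List.Forall₂ (Expr.Computes M s') l v) (hi : i + v.length ≤ w) :
    Halts M (assignList i l) s ((l.map fun e => e.cost + 1).sum + 1) fun s' =>
      (∀ j < i, s'.reg j = s.reg j) ∧ ∀ j < v.length, s'.reg (i + j) = v.getD j 0 := by
  induction l generalizing v i s with
  | nil =>
    obtain rfl := List.forall₂_nil_left_iff.1 (hl s fun _ _ => rfl)
    exact ⟨_, _, .skip _, by simp, fun _ _ => rfl, by simp⟩
  | cons e l ih =>
    obtain ⟨a, v, ha, -, rfl⟩ := List.forall₂_cons_left_iff.1 (hl s fun _ _ => rfl)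
    rw [List.length_cons] at hi
    have hseq : Halts M (.seq (.assign i e) (assignList (i + 1) l)) s
        (e.cost + 1 + ((l.map fun e => e.cost + 1).sum + 1)) fun s' =>
          (∀ j < i, s'.reg j = s.reg j) ∧
            ∀ j < (a :: v).length, s'.reg (i + j) = (a :: v).getD j 0 := by
      refine Halts.seq (Q := fun s' => s' = s.setReg i a) (Halts.assign ha.1 (by rw [ha.2])) ?_
      rintro s' rfl
      refine (ih (v := v) (fun s'' h => ?_) (by omega)).mono le_rfl ?_
      · refine (List.forall₂_cons.1 (hl s'' fun y hy => ?_)).2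
        rw [h y hy, State.reg_setReg, if_neg (by omega)]
      · rintro s'' ⟨h1, h2⟩
        refine ⟨fun j hj => ?_, fun j hj => ?_⟩
        · rw [h1 j (by omega), State.reg_setReg, if_neg (by omega)]
        · match j with
          | 0 => simp [h1 i (by omega)]
          | j + 1 =>
            rw [show i + (j + 1) = i + 1 + j by omega, h2 j (by simpa using hj),
              List.getD_cons_succ]
    refine hseq.mono ?_ fun _ h => h
    rw [List.map_cons, List.sum_cons]
    omega

lemma halts_findProg (P : Prog) {p q s : ℕ} (hq : 0 < q) (hqp : q ≤ p) (hqs : q ≤ s) :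
    ∃ C : ℕ, ∀ (x : (findCliqueProblem (s + (q + p))).Inst) (M T : ℕ),
      (x.1.n + 1) ^ (p + q + s) ≤ M →
      MultipliesBits P M T (x.1.n ^ p) (x.1.n ^ q) (x.1.n ^ s) →
      Halts M (findProg P p q s (s + (q + p))) x.1.input (T + C * (x.1.n + 1) ^ (p + s))
        ((findCliqueProblem (s + (q + p))).Correct x) := by
  set w := s + (q + p) with hw
  obtain ⟨C, hC⟩ := halts_multiplyProg P w hq hqp hqs
  refine ⟨C + ((Expr.op .mul (powExpr w p) (powExpr w s)).cost + 1 +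
    ((weightExpr p s w).cost + 1 + 2 + 6) + 2) + ((powExpr w q).cost + 1 +
    ((middleExpr p q s w).cost + 1 + 2 + 6) + 2) + ((codeExpr q s w).cost + 1) +
    (((digitExprs w w (.reg (w + 2))).map fun e => e.cost + 1).sum + 1), fun x M T hM hP => ?_⟩
  obtain ⟨x, hx⟩ := x
  set n := x.n with hn
  have hle : ∀ {u}, u ≤ p + q + s → (n + 1) ^ u ≤ M := fun h =>
    (Nat.pow_le_pow_right (Nat.succ_pos n) h).trans hM
  have hlt : ∀ {u}, u ≤ p + q + s → n ^ u ≤ M := fun h =>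
    (Nat.pow_le_pow_left (Nat.le_succ n) _).trans (hle h)
  have hnn : n * n ≤ M := by
    have h := hlt (u := 2) (by omega)
    rwa [pow_two] at h
  have hnM : n ≤ M := by simpa using hlt (u := 1) (by omega)
  have hps : n ^ p * n ^ s ≤ M := by rw [← pow_add]; exact hlt (by omega)
  have hpq : n ^ p * n ^ q ≤ M := by rw [← pow_add]; exact hlt (by omega)
  have hqs' : n ^ q * n ^ s ≤ M := by rw [← pow_add]; exact hlt (by omega)
  have hpqs : n ^ p * n ^ q * n ^ s ≤ M := by rw [← pow_add, ← pow_add]; exact hlt le_rfl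
  have hE : 1 ≤ (n + 1) ^ (p + s) := Nat.one_le_pow _ _ (Nat.succ_pos n)
  have hpsE : n ^ p * n ^ s ≤ (n + 1) ^ (p + s) := by
    rw [← pow_add]; exact Nat.pow_le_pow_left (Nat.le_succ n) _
  have hqE : n ^ q ≤ (n + 1) ^ (p + s) :=
    (Nat.pow_le_pow_left (Nat.le_succ n) _).trans
      (Nat.pow_le_pow_right (Nat.succ_pos n) (by omega))
  have hex : ∃ z < n ^ p * n ^ s, x.G.cliqueInd (s + p) z * x.productEntry p q s z ≠ 0 := by
    by_contra! h
    have h1 := x.sum_cliqueInd_mul_productEntry p q s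
    rw [Finset.sum_eq_zero fun z hz => h z (Finset.mem_range.1 hz)] at h1
    exact (SimpleGraph.copyCount_pos.2 hx).ne h1
  have hn0 : 0 < n := Nat.pos_of_ne_zero fun h => by
    obtain ⟨z, hz, -⟩ := hex
    rw [h, zero_pow (by omega), zero_mul] at hz
    omega
  have hs0 : 0 < n ^ s := by positivity
  refine ((hC x M T hM hP).seq (T' :=
    ((Expr.op .mul (powExpr w p) (powExpr w s)).cost + 1 +
      ((weightExpr p s w).cost + 1 + 2 + 6) + 2) * (n + 1) ^ (p + s) +
    (((powExpr w q).cost + 1 + ((middleExpr p q s w).cost + 1 + 2 + 6) + 2) * (n + 1) ^ (p + s) +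
    ((codeExpr q s w).cost + 1 +
    (((digitExprs w w (.reg (w + 2))).map fun e => e.cost + 1).sum + 1)))
    ) fun s1 h1 => ?_).mono ?_ fun _ h => h
  swap
  · rw [← hn]
    generalize (n + 1) ^ (p + s) = E at hE ⊢
    have h1 := Nat.le_mul_of_pos_right ((codeExpr q s w).cost + 1) hE
    have h2 := Nat.le_mul_of_pos_right
      (((digitExprs w w (.reg (w + 2))).map fun e => e.cost + 1).sum + 1) hE
    rw [add_mul, add_mul, add_mul, add_mul]
    linarith
  obtain ⟨hx1, -, hc1⟩ := h1
  refine Halts.seq ((Halts.search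
    (f := fun z => x.G.cliqueInd (s + p) z * x.productEntry p q s z) (by omega)
    (.mul (computes_powExpr hx1.reg (hle (by omega))) (computes_powExpr hx1.reg (hle (by omega)))
      hps) hex fun k hk s' hr ha hi => ?_).mono (le_of_linear hpsE hE) fun _ h => h) ?_
  · exact computes_weightExpr ⟨(hr w (by omega) (by omega)).trans hx1.reg,
      (congrFun ha 0).trans hx1.arr⟩ (by omega) hnn hps (hlt (by omega)) hk hi
      ((congrFun (congrFun ha 3) _).trans (hc1 k hk))
  rintro s2 ⟨hr2, ha2, z, hz, hfz, hz2⟩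
  have hx2 : x.HeldBy w s2 :=
    ⟨(hr2 w (by omega) (by omega)).trans hx1.reg, (congrFun ha2 0).trans hx1.arr⟩
  have hzs : z / n ^ s < n ^ p := (Nat.div_lt_iff_lt_mul hs0).2 hz
  have hzs' : z % n ^ s < n ^ s := Nat.mod_lt _ hs0
  have hzM : z ≤ M := hz.le.trans hps
  -- all numbers that the evaluation of the code goes through fit into a word
  have hcode : ∀ j < n ^ q, (z / n ^ s * n ^ q + j) * n ^ s + z % n ^ s ≤ M ∧
      (z / n ^ s * n ^ q + j) * n ^ s ≤ M ∧ z / n ^ s * n ^ q + j ≤ M ∧ z / n ^ s * n ^ q ≤ M ∧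
      j * n ^ s + z % n ^ s ≤ M ∧ j * n ^ s ≤ M := by
    intro j hj
    have h1 : z / n ^ s * n ^ q + j < n ^ p * n ^ q := by nlinarith
    have h2 : (z / n ^ s * n ^ q + j) * n ^ s + z % n ^ s < n ^ p * n ^ q * n ^ s := by nlinarith
    have h3 : j * n ^ s + z % n ^ s < n ^ q * n ^ s := by nlinarith
    exact ⟨h2.le.trans hpqs, (Nat.le_add_right _ _).trans (h2.le.trans hpqs), h1.le.trans hpq,
      (Nat.le_add_right _ _).trans (h1.le.trans hpq), h3.le.trans hqs',
      (Nat.le_add_right _ _).trans (h3.le.trans hqs')⟩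
  refine Halts.seq ((Halts.search (f := fun j => x.G.cliqueInd (q + p) (z / n ^ s * n ^ q + j) *
      x.G.cliqueInd (s + q) (j * n ^ s + z % n ^ s)) (by omega)
    (computes_powExpr hx2.reg (hle (by omega))) ?_ fun k hk s' hr ha hi => ?_).mono
      (le_of_linear hqE hE) fun _ h => h) ?_
  · obtain ⟨j, hj, h⟩ := Finset.exists_ne_zero_of_sum_ne_zero (right_ne_zero_of_mul hfz)
    exact ⟨j, Finset.mem_range.1 hj, h⟩
  · have hx' : x.HeldBy w s' :=
      ⟨(hr w (by omega) (by omega)).trans hx2.reg, (congrFun ha 0).trans hx2.arr⟩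
    obtain ⟨-, -, c1, c2, c3, c4⟩ := hcode k hk
    have hz' : (Expr.reg (w + 2)).Computes M s' z :=
      .reg ((hr _ (by omega) (by omega)).trans hz2) hzM
    have hk' : (Expr.reg (w + 1)).Computes M s' k := .reg hi (hk.le.trans (hlt (by omega)))
    have hps' := computes_powExpr (M := M) (k := s) hx'.reg (hle (by omega))
    have hpq' := computes_powExpr (M := M) (k := q) hx'.reg (hle (by omega))
    refine (computes_cliqueExpr hx' hnn hn0 (((hz'.div hps').mul hpq' c2).add hk' c1) _).mul
      (computes_cliqueExpr hx' hnn hn0 ((hk'.mul hps' c4).add (hz'.mod hps') c3) _) ?_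
    exact (Nat.mul_le_mul (x.G.cliqueInd_le_one _ _) (x.G.cliqueInd_le_one _ _)).trans
      (by nlinarith)
  rintro s3 ⟨hr3, ha3, j, hj, hfj, hj3⟩
  have hw3 : s3.reg w = n := (hr3 w (by omega) (by omega)).trans hx2.reg
  obtain ⟨c1, c2, c3, c4, -, -⟩ := hcode j hj
  have hz' : (Expr.reg (w + 2)).Computes M s3 z :=
    .reg ((hr3 _ (by omega) (by omega)).trans hz2) hzM
  have hj' : (Expr.reg (w + 3)).Computes M s3 j := .reg hj3 (hj.le.trans (hlt (by omega)))
  have hps' := computes_powExpr (M := M) (k := s) hw3 (hle (by omega))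
  have hpq' := computes_powExpr (M := M) (k := q) hw3 (hle (by omega))
  have hy := ((((hz'.div hps').mul hpq' c4).add hj' c3).mul hps' c2).add (hz'.mod hps') c1
  have hclique : x.G.IsCliqueCode w ((z / n ^ s * n ^ q + j) * n ^ s + z % n ^ s) := by
    rw [← SimpleGraph.cliqueInd_ne_zero, hw, x.G.cliqueInd_glue hj hzs', Nat.div_add_mod']
    exact mul_ne_zero (left_ne_zero_of_mul hfz) hfj
  refine Halts.seq (Q := fun s' => s' = s3.setReg (w + 2) ((codeExpr q s w).eval s3))
    (Halts.assign hy.1 rfl) ?_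
  rintro s4 rfl
  have hdigits : ∀ s' : State, (∀ y, w ≤ y → s'.reg y =
      (s3.setReg (w + 2) ((codeExpr q s w).eval s3)).reg y) →
      List.Forall₂ (Expr.Computes M s') (digitExprs w w (.reg (w + 2)))
        (digitList n w ((z / n ^ s * n ^ q + j) * n ^ s + z % n ^ s)) := by
    intro s' hr
    refine computes_digitExprs ?_ hnM (.reg ?_ c1) w
    · rw [hr w le_rfl, State.reg_setReg, if_neg (by omega), hw3]
    · rw [hr _ (by omega), State.reg_setReg, if_pos rfl]
      exact hy.2
  refine (halts_assignList (i := 0) hdigits (by simp)).mono le_rfl fun s' h => ?_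
  obtain ⟨f, hf⟩ := hclique.exists_copy hn0
  refine ⟨f, fun i => ?_⟩
  have h1 := h.2 i (by simp)
  rw [zero_add] at h1
  rw [h1, ← hf i]

end WordRAM

/-! ### Running times -/

namespace WordRAM

lemma MultipliesBits.mono {P : Prog} {M M' T a b c : ℕ} (h : MultipliesBits P M T a b c)
    (hM : M ≤ M') : MultipliesBits P M' T a b c := fun f g hf hg => by
  obtain ⟨t, s', h1, h2⟩ := h f g hf hg
  exact ⟨t, s', h1.mono hM, h2⟩

lemma SolvesInTime.trans_isBigO {P : Prog} {Q : Problem} {T T' : ℕ → ℝ} (h : SolvesInTime P Q T)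
    (hT : T =O[Filter.atTop] T') : SolvesInTime P Q T' := by
  obtain ⟨t, M, k, ht, h⟩ := h
  exact ⟨t, M, k, ht.trans hT, h⟩

/-- Additional time `O(n ^ u)` does not matter when the time bound is at least `n ^ u` in any case,
and neither does an additional polynomial in the bound for the words. -/
lemma solvesInTime_of_halts {P : Prog} {Q : Problem} {t M : ℕ → ℕ} {T : ℕ → ℝ} {C k u v : ℕ}
    (ht : (fun n => (t n : ℝ)) =O[Filter.atTop] T)
    (hM : (fun n => (M n : ℝ)) =O[Filter.atTop] fun n : ℕ => (n : ℝ) ^ k)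
    (hu : ∀ n, 0 < n → n ^ u ≤ t n)
    (h : ∀ x : Q.Inst, Halts (M (Q.size x) + (Q.size x + 1) ^ v) P (Q.input x)
      (t (Q.size x) + C * (Q.size x + 1) ^ u) (Q.Correct x)) : SolvesInTime P Q T := by
  refine ⟨fun n => t n + C * (n + 1) ^ u, fun n => M n + (n + 1) ^ v, max k v, ?_, ?_, h⟩
  · push_cast
    refine ht.add (((isBigO_add_one_pow u).const_mul_left _).trans (.trans ?_ ht))
    refine Asymptotics.IsBigO.of_bound 1 (Filter.eventually_atTop.2 ⟨1, fun n hn => ?_⟩)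
    rw [Real.norm_of_nonneg (by positivity), Real.norm_of_nonneg (by positivity), one_mul]
    exact_mod_cast hu n hn
  · push_cast
    have hpow : ∀ {i j : ℕ}, i ≤ j → (fun n : ℕ => (n : ℝ) ^ i) =O[Filter.atTop]
        fun n : ℕ => (n : ℝ) ^ j := fun {i j} hij => by
      refine Asymptotics.IsBigO.of_bound 1 (Filter.eventually_atTop.2 ⟨1, fun n hn => ?_⟩)
      rw [Real.norm_of_nonneg (by positivity), Real.norm_of_nonneg (by positivity), one_mul]
      exact pow_le_pow_right₀ (by exact_mod_cast hn) hij
    exact (hM.trans (hpow (le_max_left _ _))).add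
      ((isBigO_add_one_pow v).trans (hpow (le_max_right _ _)))

end WordRAM

theorem MatMulInTime.countCliques {p q s : ℕ} {τ : ℝ} (h : MatMulInTime p q s τ) (hq : 0 < q)
    (hqp : q ≤ p) (hqs : q ≤ s) : CountCliquesInTime (s + (q + p)) fun n => (n : ℝ) ^ τ := by
  obtain ⟨P, t, M, k, ht, hM, hlow, hP⟩ := h.exists_multipliesBits
  obtain ⟨C, hC⟩ := halts_countProg P hq hqp hqs
  exact ⟨_, solvesInTime_of_halts (v := p + q + s) ht hM hlow fun x =>
    hC x _ _ (Nat.le_add_left _ _) ((hP _).mono (Nat.le_add_right _ _))⟩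

theorem MatMulInTime.findClique {p q s : ℕ} {τ : ℝ} (h : MatMulInTime p q s τ) (hq : 0 < q)
    (hqp : q ≤ p) (hqs : q ≤ s) : FindCliqueInSoftTime (s + (q + p)) fun n => (n : ℝ) ^ τ := by
  obtain ⟨P, t, M, k, ht, hM, hlow, hP⟩ := h.exists_multipliesBits
  obtain ⟨C, hC⟩ := halts_findProg P hq hqp hqs
  refine ⟨0, findProg P p q s (s + (q + p)), ?_⟩
  simp only [pow_zero, mul_one]
  exact solvesInTime_of_halts (v := p + q + s) ht hM hlow fun x =>
    hC x _ _ (Nat.le_add_left _ _) ((hP _).mono (Nat.le_add_right _ _))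

/-- Multiplication by the definition shows that the infimum `omega` is over a nonempty set, so that
it is approached by exponents that are attained. -/
lemma exists_matMulInTime_lt {ε : ℝ} (hε : 0 < ε) (p q s : ℕ) :
    ∃ τ < omega p q s + ε, MatMulInTime p q s τ := by
  obtain ⟨τ, h, hτ⟩ := exists_lt_of_csInf_lt (s := {τ : ℝ | MatMulInTime p q s τ})
    ⟨_, matMulInTime_naive p q s⟩ (lt_add_of_pos_right (omega p q s) hε)
  exact ⟨τ, hτ, h⟩

lemma isBigO_rpow_of_le {a b : ℝ} (h : a ≤ b) :
    (fun n : ℕ => (n : ℝ) ^ a) =O[Filter.atTop] fun n : ℕ => (n : ℝ) ^ b := by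
  refine Asymptotics.IsBigO.of_bound 1 (Filter.eventually_atTop.2 ⟨1, fun n hn => ?_⟩)
  rw [Real.norm_of_nonneg (by positivity), Real.norm_of_nonneg (by positivity), one_mul]
  exact Real.rpow_le_rpow_of_exponent_le (by exact_mod_cast hn) h

lemma CountCliquesInTime.trans_isBigO {r : ℕ} {T T' : ℕ → ℝ} (h : CountCliquesInTime r T)
    (hT : T =O[Filter.atTop] T') : CountCliquesInTime r T' := by
  obtain ⟨P, hP⟩ := h
  exact ⟨P, hP.trans_isBigO hT⟩

lemma FindCliqueInSoftTime.trans_isBigO {r : ℕ} {T T' : ℕ → ℝ} (h : FindCliqueInSoftTime r T)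
    (hT : T =O[Filter.atTop] T') : FindCliqueInSoftTime r T' := by
  obtain ⟨k, P, hP⟩ := h
  exact ⟨k, P, hP.trans_isBigO (hT.mul (Asymptotics.isBigO_refl _ _))⟩

/-- Since `ω` is an infimum, a bound `O(n ^ ω)` is read as `O(n ^ (ω + ε))` for every `ε > 0`
(first part), and with the exponent `τ` itself for every `τ`, in particular `τ = ω`, such that the
matrices can be multiplied in time `O(n ^ τ)` (second part). -/
theorem mainTheorem3 :
    (∀ ε : ℝ, 0 < ε →
      CountCliquesInTime 4 (fun n => (n : ℝ) ^ (omega 2 1 1 + ε)) ∧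
      CountCliquesInTime 5 (fun n => (n : ℝ) ^ (omega 2 1 2 + ε)) ∧
      FindCliqueInSoftTime 4 (fun n => (n : ℝ) ^ (omega 2 1 1 + ε)) ∧
      FindCliqueInSoftTime 5 (fun n => (n : ℝ) ^ (omega 2 1 2 + ε))) ∧
    (∀ τ : ℝ, MatMulInTime 2 1 1 τ →
      CountCliquesInTime 4 (fun n => (n : ℝ) ^ τ) ∧
      FindCliqueInSoftTime 4 (fun n => (n : ℝ) ^ τ)) ∧
    (∀ τ : ℝ, MatMulInTime 2 1 2 τ →
      CountCliquesInTime 5 (fun n => (n : ℝ) ^ τ) ∧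
      FindCliqueInSoftTime 5 (fun n => (n : ℝ) ^ τ)) := by
  have four : ∀ τ : ℝ, MatMulInTime 2 1 1 τ →
      CountCliquesInTime 4 (fun n => (n : ℝ) ^ τ) ∧
      FindCliqueInSoftTime 4 (fun n => (n : ℝ) ^ τ) := fun τ h => by
    have h' : MatMulInTime (2 : ℕ) (1 : ℕ) (1 : ℕ) τ := by simpa using h
    exact ⟨h'.countCliques (by norm_num) (by norm_num) (by norm_num),
      h'.findClique (by norm_num) (by norm_num) (by norm_num)⟩
  have five : ∀ τ : ℝ, MatMulInTime 2 1 2 τ →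
      CountCliquesInTime 5 (fun n => (n : ℝ) ^ τ) ∧
      FindCliqueInSoftTime 5 (fun n => (n : ℝ) ^ τ) := fun τ h => by
    have h' : MatMulInTime (2 : ℕ) (1 : ℕ) (2 : ℕ) τ := by simpa using h
    exact ⟨h'.countCliques (by norm_num) (by norm_num) (by norm_num),
      h'.findClique (by norm_num) (by norm_num) (by norm_num)⟩
  refine ⟨fun ε hε => ?_, four, five⟩
  obtain ⟨τ, hτ, h⟩ := exists_matMulInTime_lt hε 2 1 1
  obtain ⟨σ, hσ, h'⟩ := exists_matMulInTime_lt hε 2 1 2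
  simp only [Nat.cast_ofNat, Nat.cast_one] at hτ h hσ h'
  exact ⟨(four τ h).1.trans_isBigO (isBigO_rpow_of_le hτ.le),
    (five σ h').1.trans_isBigO (isBigO_rpow_of_le hσ.le),
    (four τ h).2.trans_isBigO (isBigO_rpow_of_le hτ.le),
    (five σ h').2.trans_isBigO (isBigO_rpow_of_le hσ.le)⟩
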